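/- Let $G(m,p)$ be the random graph on $m$ vertices in which each pair of vertices is joined by an edge with probability $p$, independently of all other pairs, and let $|\mathcal C_1|$ be the number of vertices of its largest connected component. There exist absolute constants $A>0$ and $C>0$ such that the following holds. Let $\varepsilon=\varepsilon(m)$ be any sequence of real numbers with $\varepsilon(m)\to 0$ as $m\to\infty$ and $\varepsilon(m)^3 m\ge A\log m$ for all sufficiently large $m$, and let $p=p(m)=\frac{1+\varepsilon(m)}{m}$ (which lies in $[0,1]$ for all large $m$). Then, for all sufficiently large $m$, $$\mathbb E|\mathcal C_1|\le 2\varepsilon m-\tfrac83\,\varepsilon^2 m+C\varepsilon^3 m$$ and $$\mathbb E|\mathcal C_1|\ge 2\varepsilon m-C\left(\varepsilon^{-2}+\varepsilon^2 m\right).$$ -/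

import Mathlib

open MeasureTheory ProbabilityTheory Filter Topology

/-- The number of vertices of a largest connected component of a finite graph `G`
(it is `0` if `G` has no vertices). -/
noncomputable def SimpleGraph.largestComponentSize {V : Type*} [Finite V] (G : SimpleGraph V) : ℕ :=
  ⨆ c : G.ConnectedComponent, c.supp.ncard

/-- The expected size of a largest component of the binomial random graph on `m` vertices, in
which every pair of vertices is an edge with probability `p`, independently. -/
noncomputable def expectedLargestComponent (m : ℕ) (p : unitInterval) : ℝ :=
  ∫ G, (G.largestComponentSize : ℝ) ∂(SimpleGraph.binomialRandom (Fin m) p)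

/-- Every real function on the graphs on `Fin m` is integrable for the binomial random graph, so
the expectation above is a genuine (finite) average over graphs. -/
theorem integrable_binomialRandom (m : ℕ) (p : unitInterval) (f : SimpleGraph (Fin m) → ℝ) :
    Integrable f (SimpleGraph.binomialRandom (Fin m) p) := by
  have : MeasurableSingletonClass (SimpleGraph (Fin m)) := by
    refine ⟨fun G => ?_⟩
    have h : ({G} : Set (SimpleGraph (Fin m))) = SimpleGraph.edgeSet ⁻¹' {G.edgeSet} := by
      ext H
      simp
    rw [h]
    exact SimpleGraph.measurableEmbedding_edgeSet.measurable (measurableSet_singleton _)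
  exact .of_finite

/-! Write μ(n,t) for `compMean p n t`, the expected number of vertices of G(n,p) lying in components
of order t, with the same p for every n. Two facts drive the proof: Σ_t μ(n,t) = n for all n
(`sum_compMean`), and in μ(n,t)/μ(N,t) the unknown connectivity probability cancels. For n ≤ N near
m that ratio is about exp(tδ(ε - w)), where δ = (N-n)/m and m(1-w) is the midpoint of n and N. So
its direction depends on which side of the critical order m(1-ε) the midpoint lies. In particular
the orders m and m-d with d ≈ 2εm have nearly equal counts of small components: this is the duality
principle, obtained without branching processes.

Fix k ≈ εm/10. Since G(m-d,p) is subcritical, nearly all its m-d vertices lie in small components,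
so G(m,p) has about m-d vertices in small components and `bigMean p k m` ≈ d. The upper bound
(`bigMean_le_upper`) takes d just large enough that μ(m-d,t) ≤ μ(m,t) for every t. The lower bound
(`le_bigMean`) takes d slightly smaller and pays an error that is a second moment of subcritical
component sizes, bounded by `sum_mul_compMean_le`.

To pass from vertices in big components to the largest one, removing the component of a vertex
leaves an independent binomial random graph (`randomMean_sum_compSet`). This yields exponentially
small bounds for having no big component (`noBigProb_le_exp`) and for the contribution of a second
one (`sum_compMean_mul_bigMean_le`). -/

namespace SimpleGraph

/-! ### Expectations as finite weighted sums. -/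

/-- The average of `f` over the binomial random graph on `V`. -/
noncomputable def randomMean (V : Type*) (p : unitInterval) (f : SimpleGraph V → ℝ) : ℝ :=
  ∫ G, f G ∂(binomialRandom V p)

/-- The probability of `G` in the binomial random graph. -/
noncomputable def randomWeight {V : Type*} (p : ℝ) (G : SimpleGraph V) : ℝ :=
  p ^ G.edgeSet.ncard * (1 - p) ^ ((Nat.card V).choose 2 - G.edgeSet.ncard)

theorem measurableSingletonClass {V : Type*} [Finite V] :
    MeasurableSingletonClass (SimpleGraph V) := by
  refine ⟨fun G => ?_⟩
  have h : ({G} : Set (SimpleGraph V)) = SimpleGraph.edgeSet ⁻¹' {G.edgeSet} := by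
    ext H
    simp
  rw [h]
  exact measurableEmbedding_edgeSet.measurable (measurableSet_singleton _)

theorem randomMean_eq_sum {V : Type*} [Finite V] [Fintype (SimpleGraph V)] (p : unitInterval)
    (f : SimpleGraph V → ℝ) :
    randomMean V p f = ∑ G, randomWeight (p : ℝ) G * f G := by
  have := measurableSingletonClass (V := V)
  rw [randomMean, integral_fintype .of_finite]
  refine Finset.sum_congr rfl fun G _ => ?_
  rw [smul_eq_mul, measureReal_def, binomialRandom_singleton, randomWeight]
  simp

theorem randomWeight_nonneg {V : Type*} (p : unitInterval) (G : SimpleGraph V) :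
    0 ≤ randomWeight (p : ℝ) G :=
  mul_nonneg (pow_nonneg p.2.1 _) (pow_nonneg (sub_nonneg.2 p.2.2) _)

section Mean

variable {V : Type*} [Finite V] (p : unitInterval)

theorem randomMean_mono {f g : SimpleGraph V → ℝ} (h : ∀ G, f G ≤ g G) :
    randomMean V p f ≤ randomMean V p g := by
  cases nonempty_fintype (SimpleGraph V)
  rw [randomMean_eq_sum, randomMean_eq_sum]
  exact Finset.sum_le_sum fun G _ => mul_le_mul_of_nonneg_left (h G) (randomWeight_nonneg p G)

theorem randomMean_add (f g : SimpleGraph V → ℝ) :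
    randomMean V p (fun G => f G + g G) = randomMean V p f + randomMean V p g := by
  cases nonempty_fintype (SimpleGraph V)
  simp only [randomMean_eq_sum, mul_add, Finset.sum_add_distrib]

theorem randomMean_const_mul (c : ℝ) (f : SimpleGraph V → ℝ) :
    randomMean V p (fun G => c * f G) = c * randomMean V p f := by
  cases nonempty_fintype (SimpleGraph V)
  simp only [randomMean_eq_sum, Finset.mul_sum, mul_left_comm]

theorem randomMean_sum {ι : Type*} (s : Finset ι) (f : ι → SimpleGraph V → ℝ) :
    randomMean V p (fun G => ∑ i ∈ s, f i G) = ∑ i ∈ s, randomMean V p (f i) := by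
  cases nonempty_fintype (SimpleGraph V)
  simp only [randomMean_eq_sum, Finset.mul_sum]
  exact Finset.sum_comm

theorem randomMean_const (c : ℝ) : randomMean V p (fun _ => c) = c := by
  simp [randomMean]

theorem randomMean_nonneg {f : SimpleGraph V → ℝ} (h : ∀ G, 0 ≤ f G) :
    0 ≤ randomMean V p f := by
  simpa [randomMean_const] using randomMean_mono p (f := fun _ => (0 : ℝ)) h

theorem randomMean_equiv {W : Type*} [Finite W] (e : V ≃ W) (f : SimpleGraph W → ℝ) :
    randomMean V p (fun G => f (e.simpleGraph G)) = randomMean W p f := by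
  cases nonempty_fintype (SimpleGraph V)
  cases nonempty_fintype (SimpleGraph W)
  rw [randomMean_eq_sum, randomMean_eq_sum]
  refine Fintype.sum_equiv e.simpleGraph _ _ fun G => ?_
  congr 1
  have h : (e.simpleGraph G).edgeSet.ncard = G.edgeSet.ncard := by
    have : e.simpleGraph G = G.map e.toEmbedding := by
      ext a b
      change G.Adj (e.symm a) (e.symm b) ↔ _
      rw [SimpleGraph.map_adj]
      constructor
      · intro h
        exact ⟨_, _, h, by simp, by simp⟩
      · rintro ⟨u, v, h, rfl, rfl⟩
        simpa using h
    rw [this, edgeSet_map, Set.ncard_image_of_injective _ (Function.Embedding.injective _)]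
  rw [randomWeight, randomWeight, h, Nat.card_congr e]

end Mean

theorem edgeSet_ncard_le {V : Type*} [Finite V] (G : SimpleGraph V) :
    G.edgeSet.ncard ≤ (Nat.card V).choose 2 := by
  classical
  cases nonempty_fintype V
  have := G.card_edgeFinset_le_card_choose_two
  rwa [← coe_edgeFinset, Set.ncard_coe_finset, Nat.card_eq_fintype_card]

/-! ### Cuts and independence of the two sides. -/

/-- No edge of `G` joins `K` to its complement. -/
def IsCut {V : Type*} (G : SimpleGraph V) (K : Set V) : Prop :=
  ∀ a ∈ K, ∀ b ∉ K, ¬ G.Adj a b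

/-- The disjoint union of a graph on `K` and a graph on the complement of `K`. -/
def glue {V : Type*} (K : Set V) (H : SimpleGraph K) (H' : SimpleGraph ↥Kᶜ) : SimpleGraph V :=
  H.map (Function.Embedding.subtype _) ⊔ H'.map (Function.Embedding.subtype _)

section Glue

variable {V : Type*} (K : Set V) (H : SimpleGraph K) (H' : SimpleGraph ↥Kᶜ)

theorem glue_adj (a b : V) : (glue K H H').Adj a b ↔
    (∃ (ha : a ∈ K) (hb : b ∈ K), H.Adj ⟨a, ha⟩ ⟨b, hb⟩) ∨
      ∃ (ha : a ∈ Kᶜ) (hb : b ∈ Kᶜ), H'.Adj ⟨a, ha⟩ ⟨b, hb⟩ := by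
  simp only [glue, sup_adj, map_adj]
  constructor
  · rintro (⟨⟨u, hu⟩, ⟨v, hv⟩, h, rfl, rfl⟩ | ⟨⟨u, hu⟩, ⟨v, hv⟩, h, rfl, rfl⟩)
    · exact .inl ⟨hu, hv, h⟩
    · exact .inr ⟨hu, hv, h⟩
  · rintro (⟨ha, hb, h⟩ | ⟨ha, hb, h⟩)
    · exact .inl ⟨_, _, h, rfl, rfl⟩
    · exact .inr ⟨_, _, h, rfl, rfl⟩

theorem isCut_glue : (glue K H H').IsCut K := by
  intro a ha b hb h
  rw [glue_adj] at h
  rcases h with ⟨_, h, _⟩ | ⟨h, _, _⟩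
  · exact hb h
  · exact h ha

theorem induce_glue : (glue K H H').induce K = H := by
  ext ⟨a, ha⟩ ⟨b, hb⟩
  rw [comap_adj, glue_adj]
  simp [ha, hb]

theorem induce_compl_glue : (glue K H H').induce Kᶜ = H' := by
  ext ⟨a, ha⟩ ⟨b, hb⟩
  rw [comap_adj, glue_adj]
  have ha' : a ∉ K := ha
  have hb' : b ∉ K := hb
  simp [ha', hb']

theorem glue_induce {G : SimpleGraph V} (h : G.IsCut K) :
    glue K (G.induce K) (G.induce Kᶜ) = G := by
  ext a b
  rw [glue_adj]
  by_cases ha : a ∈ K <;> by_cases hb : b ∈ K <;> simp [ha, hb]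
  · exact h a ha b hb
  · exact fun h' => h b hb a ha h'.symm

theorem randomWeight_glue [Finite V] (p : ℝ) :
    randomWeight p (glue K H H') =
      (1 - p) ^ (K.ncard * Kᶜ.ncard) * (randomWeight p H * randomWeight p H') := by
  have he : (glue K H H').edgeSet.ncard = H.edgeSet.ncard + H'.edgeSet.ncard := by
    rw [glue, edgeSet_sup, edgeSet_map, edgeSet_map, Set.ncard_union_eq,
      Set.ncard_image_of_injective _ (Function.Embedding.injective _),
      Set.ncard_image_of_injective _ (Function.Embedding.injective _)]
    rw [Set.disjoint_left]
    rintro _ ⟨e, -, rfl⟩ ⟨e', -, h⟩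
    induction e with | _ a b
    induction e' with | _ a' b'
    simp only [Function.Embedding.sym2Map_apply, Sym2.map_mk, Function.Embedding.subtype_apply,
      Sym2.eq_iff] at h
    rcases h with ⟨h, -⟩ | ⟨h, -⟩
    · exact a'.2 (h ▸ a.2)
    · exact a'.2 (h ▸ b.2)
  have hc : (Nat.card V).choose 2 =
      (Nat.card K).choose 2 + (Nat.card ↥Kᶜ).choose 2 + K.ncard * Kᶜ.ncard := by
    have hV : Nat.card V = K.ncard + Kᶜ.ncard := (Set.ncard_add_ncard_compl K).symm
    rw [hV, Nat.card_coe_set_eq, Nat.card_coe_set_eq, Nat.add_choose_eq]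
    simp [Finset.Nat.antidiagonal_succ]
    ring
  have h1 := H.edgeSet_ncard_le
  have h2 := H'.edgeSet_ncard_le
  have h3 : (Nat.card V).choose 2 - (H.edgeSet.ncard + H'.edgeSet.ncard) =
      K.ncard * Kᶜ.ncard + ((Nat.card K).choose 2 - H.edgeSet.ncard) +
        ((Nat.card ↥Kᶜ).choose 2 - H'.edgeSet.ncard) := by
    omega
  rw [randomWeight, randomWeight, randomWeight, he, h3, pow_add, pow_add, pow_add]
  ring

-- Gluing is a bijection from pairs of graphs on the two sides onto the graphs for which `K` is a
-- cut. The weight factorises, the power of 1 - p paying for the absent cross pairs.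
open scoped Classical in
theorem randomMean_isCut [Finite V] (p : unitInterval) (f : SimpleGraph K → ℝ)
    (g : SimpleGraph ↥Kᶜ → ℝ) :
    randomMean V p (fun G => if G.IsCut K then f (G.induce K) * g (G.induce Kᶜ) else 0) =
      (1 - (p : ℝ)) ^ (K.ncard * Kᶜ.ncard) * (randomMean K p f * randomMean ↥Kᶜ p g) := by
  cases nonempty_fintype (SimpleGraph V)
  cases nonempty_fintype (SimpleGraph K)
  cases nonempty_fintype (SimpleGraph ↥Kᶜ)
  rw [randomMean_eq_sum, randomMean_eq_sum, randomMean_eq_sum, Finset.sum_mul_sum,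
    ← Finset.sum_product', Finset.mul_sum]
  simp only [mul_ite, mul_zero]
  rw [← Finset.sum_filter]
  refine Finset.sum_nbij' (fun G => (G.induce K, G.induce Kᶜ)) (fun P => glue K P.1 P.2)
    (by simp) (by simp [isCut_glue]) ?_ ?_ ?_
  · intro G hG
    exact glue_induce K (by simpa using hG)
  · rintro ⟨H, H'⟩ -
    simp [induce_glue, induce_compl_glue]
  · intro G hG
    conv_lhs => rw [← glue_induce K (G := G) (by simpa using hG)]
    rw [randomWeight_glue, induce_glue, induce_compl_glue]
    ring

end Glue

end SimpleGraph

/-! ### Components and deterministic inequalities for big components. -/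

namespace SimpleGraph

/-- The set of vertices of the component of `v`. -/
def compSet {V : Type*} (G : SimpleGraph V) (v : V) : Set V := (G.connectedComponentMk v).supp

/-- The number of vertices of the component of `v`. -/
noncomputable def compSize {V : Type*} (G : SimpleGraph V) (v : V) : ℕ := (G.compSet v).ncard

section Components

variable {V : Type*} {G : SimpleGraph V}

theorem mem_compSet {v w : V} : w ∈ G.compSet v ↔ G.Reachable w v := by
  rw [compSet, ConnectedComponent.mem_supp_iff, ConnectedComponent.eq]

theorem self_mem_compSet (v : V) : v ∈ G.compSet v := mem_compSet.2 (Reachable.refl v)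

theorem compSet_eq_of_mem {v w : V} (h : w ∈ G.compSet v) : G.compSet w = G.compSet v := by
  ext x
  rw [mem_compSet, mem_compSet]
  exact ⟨fun hx => hx.trans (mem_compSet.1 h), fun hx => hx.trans (mem_compSet.1 h).symm⟩

theorem IsCut.reachable_induce {S : Set V} (hS : G.IsCut S) {a b : V} (h : G.Reachable a b)
    (ha : a ∈ S) : ∃ hb : b ∈ S, (G.induce S).Reachable ⟨a, ha⟩ ⟨b, hb⟩ := by
  obtain ⟨p⟩ := h
  induction p with
  | nil => exact ⟨ha, Reachable.refl _⟩
  | @cons u v w hadj p ih =>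
    have hv : v ∈ S := by
      by_contra hv
      exact hS u ha v hv hadj
    obtain ⟨hb, h⟩ := ih hv
    exact ⟨hb, (show (G.induce S).Adj ⟨u, ha⟩ ⟨v, hv⟩ from hadj).reachable.trans h⟩

theorem IsCut.compl {S : Set V} (hS : G.IsCut S) : G.IsCut Sᶜ :=
  fun a ha b hb h => hS b (not_not.1 hb) a ha h.symm

theorem isCut_compSet (v : V) : G.IsCut (G.compSet v) := fun _ ha _ hb h =>
  hb (mem_compSet.2 (h.symm.reachable.trans (mem_compSet.1 ha)))

theorem compSet_eq_iff {v : V} {K : Set V} :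
    G.compSet v = K ↔ v ∈ K ∧ G.IsCut K ∧ (G.induce K).Connected := by
  constructor
  · rintro rfl
    exact ⟨self_mem_compSet v, isCut_compSet v, ConnectedComponent.connected_toSimpleGraph _⟩
  · rintro ⟨hv, hK, hc⟩
    ext w
    rw [mem_compSet]
    constructor
    · intro h
      exact (hK.reachable_induce h.symm hv).1
    · intro hw
      exact (hc.preconnected ⟨w, hw⟩ ⟨v, hv⟩).map (Embedding.induce K).toHom

theorem IsCut.compSize_induce {S : Set V} (hS : G.IsCut S) (w : S) :
    (G.induce S).compSize w = G.compSize w := by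
  rw [compSize, compSize, ← Set.ncard_image_of_injective _ Subtype.val_injective]
  congr 1
  ext x
  simp only [Set.mem_image, mem_compSet]
  constructor
  · rintro ⟨y, hy, rfl⟩
    exact hy.map (Embedding.induce S).toHom
  · intro h
    obtain ⟨hx, h'⟩ := hS.reachable_induce h.symm w.2
    exact ⟨⟨x, hx⟩, h'.symm, rfl⟩

/-- The number of vertices in components with at least `k` vertices. -/
noncomputable def bigCount (k : ℕ) (G : SimpleGraph V) : ℕ := {v | k ≤ G.compSize v}.ncard

open scoped Classical in
/-- The indicator of the event that all components have fewer than `k` vertices. -/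
noncomputable def noBig (k : ℕ) (G : SimpleGraph V) : ℝ := if ∀ v, G.compSize v < k then 1 else 0

theorem compSize_equiv {W : Type*} (e : V ≃ W) (w : V) :
    (e.simpleGraph G).compSize (e w) = G.compSize w := by
  let φ : G ≃g e.simpleGraph G := ⟨e, by
    intro a b
    change G.Adj (e.symm (e a)) (e.symm (e b)) ↔ _
    simp⟩
  rw [compSize, compSize, ← Set.ncard_image_of_injective _ e.injective]
  congr 1
  ext x
  obtain ⟨y, rfl⟩ := e.surjective x
  simp only [e.injective.mem_set_image, mem_compSet]
  exact φ.reachable_iff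

theorem bigCount_equiv {W : Type*} (k : ℕ) (e : V ≃ W) :
    bigCount k (e.simpleGraph G) = bigCount k G := by
  rw [bigCount, bigCount, ← Set.ncard_image_of_injective _ e.injective]
  congr 1
  ext x
  obtain ⟨y, rfl⟩ := e.surjective x
  rw [e.injective.mem_set_image]
  exact Eq.to_iff (congrArg (k ≤ ·) (compSize_equiv e y))

theorem noBig_equiv {W : Type*} (k : ℕ) (e : V ≃ W) :
    noBig k (e.simpleGraph G) = noBig k G := by
  rw [noBig, noBig]
  congr 1
  rw [← e.forall_congr_right]
  simp only [compSize_equiv]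

theorem connected_equiv {W : Type*} (e : V ≃ W) :
    (e.simpleGraph G).Connected ↔ G.Connected := by
  let φ : G ≃g e.simpleGraph G := ⟨e, by
    intro a b
    change G.Adj (e.symm (e a)) (e.symm (e b)) ↔ _
    simp⟩
  exact φ.connected_iff.symm

theorem noBig_nonneg (k : ℕ) (G : SimpleGraph V) : 0 ≤ noBig k G := by
  rw [noBig]
  split_ifs <;> norm_num

theorem noBig_le_one (k : ℕ) (G : SimpleGraph V) : noBig k G ≤ 1 := by
  rw [noBig]
  split_ifs <;> norm_num

theorem compSize_le_largestComponentSize [Finite V] (v : V) :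
    G.compSize v ≤ G.largestComponentSize :=
  le_ciSup (f := fun c : G.ConnectedComponent => c.supp.ncard) (Set.finite_range _).bddAbove _

theorem exists_compSize_eq_largestComponentSize [Finite V] [Nonempty V] (G : SimpleGraph V) :
    ∃ v, G.compSize v = G.largestComponentSize := by
  obtain ⟨c, hc⟩ := exists_eq_ciSup_of_finite (f := fun c : G.ConnectedComponent => c.supp.ncard)
  obtain ⟨v, rfl⟩ := c.exists_rep
  exact ⟨v, hc⟩

/-- Either the largest component is itself among the counted vertices, or all components are smaller
than `k`. -/
theorem largestComponentSize_le [Finite V] (k : ℕ) (G : SimpleGraph V) :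
    (G.largestComponentSize : ℝ) ≤ bigCount k G + k * noBig k G := by
  rcases isEmpty_or_nonempty V with hV | hV
  · have : IsEmpty G.ConnectedComponent := ⟨fun c => by
      obtain ⟨v, -⟩ := c.exists_rep
      exact hV.elim v⟩
    rw [largestComponentSize, ciSup_of_empty]
    have := noBig_nonneg k G
    simp only [bot_eq_zero', Nat.cast_zero]
    positivity
  obtain ⟨v, hv⟩ := G.exists_compSize_eq_largestComponentSize
  rw [← hv]
  by_cases h : ∀ v, G.compSize v < k
  · have := (h v).le
    rw [noBig, if_pos h, mul_one]
    have h1 : (G.compSize v : ℝ) ≤ k := by exact_mod_cast this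
    have h2 : (0 : ℝ) ≤ bigCount k G := by positivity
    linarith
  · have hk : k ≤ G.compSize v := by
      push Not at h
      obtain ⟨w, hw⟩ := h
      exact hv ▸ hw.trans (compSize_le_largestComponentSize w)
    rw [noBig, if_neg h, mul_zero, add_zero]
    refine Nat.cast_le.2 (Set.ncard_le_ncard (fun w hw => ?_) (Set.toFinite _))
    rw [Set.mem_ofPred_eq, compSize, compSet_eq_of_mem hw]
    exact hk

-- Deleting a whole component does not alter the others, so if no component is big every summand on
-- the right equals 1. Averaged, this becomes the recursion behind `noBigProb_le`.
open scoped Classical in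
theorem noBig_le [Fintype V] (k : ℕ) (G : SimpleGraph V) :
    (Fintype.card V : ℝ) * noBig k G ≤
      ∑ v, (if (G.compSet v).ncard < k then 1 else 0) * noBig k (G.induce (G.compSet v)ᶜ) := by
  by_cases h : ∀ v, G.compSize v < k
  · have h2 : ∀ v, noBig k (G.induce (G.compSet v)ᶜ) = 1 := fun v => by
      rw [noBig, if_pos]
      intro w
      rw [(isCut_compSet v).compl.compSize_induce]
      exact h _
    have h3 : ∀ v, (G.compSet v).ncard < k := h
    simp only [h2, h3, if_true, mul_one]
    simp [noBig, h]
  · rw [noBig, if_neg h, mul_zero]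
    refine Finset.sum_nonneg fun v _ => mul_nonneg ?_ (noBig_nonneg _ _)
    split_ifs <;> norm_num

-- A single vertex `v` of a big component suffices: the big vertices outside that component are
-- exactly the big vertices of what remains, and the component itself is at most the largest one.
open scoped Classical in
theorem bigCount_le [Fintype V] (k : ℕ) (G : SimpleGraph V) :
    (bigCount k G : ℝ) ≤ G.largestComponentSize +
      ∑ v, (if k ≤ (G.compSet v).ncard then 1 else 0) * (bigCount k (G.induce (G.compSet v)ᶜ) : ℝ) := by
  have hnn : ∀ v ∈ (Finset.univ : Finset V), 0 ≤ (if k ≤ (G.compSet v).ncard then (1 : ℝ) else 0) *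
      (bigCount k (G.induce (G.compSet v)ᶜ) : ℝ) := fun v _ => by
    split_ifs <;> simp
  by_cases h : ∃ v, k ≤ G.compSize v
  · obtain ⟨v, hv⟩ := h
    have h1 := Finset.single_le_sum hnn (Finset.mem_univ v)
    rw [if_pos (show k ≤ (G.compSet v).ncard from hv), one_mul] at h1
    have h2 : bigCount k G ≤ G.compSize v + bigCount k (G.induce (G.compSet v)ᶜ) := by
      rw [bigCount, bigCount, ← Set.ncard_image_of_injective _ Subtype.val_injective, compSize]
      refine (Set.ncard_le_ncard (fun w hw => ?_) (Set.toFinite _)).trans (Set.ncard_union_le _ _)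
      by_cases hm : w ∈ G.compSet v
      · exact .inl hm
      · refine .inr ⟨⟨w, hm⟩, ?_, rfl⟩
        rw [Set.mem_ofPred_eq, (isCut_compSet v).compl.compSize_induce]
        exact hw
    have h3 : (bigCount k G : ℝ) ≤ G.compSize v + bigCount k (G.induce (G.compSet v)ᶜ) := by
      exact_mod_cast h2
    have h4 : (G.compSize v : ℝ) ≤ G.largestComponentSize := by
      exact_mod_cast compSize_le_largestComponentSize v
    linarith
  · push Not at h
    have h1 : bigCount k G = 0 := by
      rw [bigCount]
      simp [fun v => (h v).not_ge]
    rw [h1, Nat.cast_zero]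
    have := Finset.sum_nonneg hnn
    positivity

theorem bigCount_eq_sum [Fintype V] (k : ℕ) (G : SimpleGraph V) :
    (bigCount k G : ℝ) = ∑ v, if k ≤ (G.compSet v).ncard then (1 : ℝ) else 0 := by
  classical
  rw [bigCount, Set.ncard_eq_toFinset_card', Finset.sum_boole]
  congr 2
  ext v
  rw [Set.mem_toFinset, Finset.mem_filter]
  exact ⟨fun h => ⟨Finset.mem_univ v, h⟩, fun h => h.2⟩

end Components

/-! ### Expected component counts and recursions. -/

open scoped Classical in
/-- The indicator of the event that the graph is connected. -/
noncomputable def connIndicator {V : Type*} (G : SimpleGraph V) : ℝ := if G.Connected then 1 else 0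

theorem connIndicator_equiv {V W : Type*} (e : V ≃ W) (G : SimpleGraph V) :
    connIndicator (e.simpleGraph G) = connIndicator G := by
  by_cases h : G.Connected
  · rw [connIndicator, connIndicator, if_pos h, if_pos ((connected_equiv e).2 h)]
  · rw [connIndicator, connIndicator, if_neg h, if_neg fun h' => h ((connected_equiv e).1 h')]

/-- The probability that the binomial random graph on `t` vertices is connected. -/
noncomputable def connProb (p : unitInterval) (t : ℕ) : ℝ :=
  randomMean (Fin t) p connIndicator

/-- The expected number of vertices in components with exactly `t` vertices, in the binomial random
graph on `n` vertices. -/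
noncomputable def compMean (p : unitInterval) (n t : ℕ) : ℝ :=
  n.choose t * (t * (connProb p t * (1 - (p : ℝ)) ^ (t * (n - t))))

theorem connProb_nonneg (p : unitInterval) (t : ℕ) : 0 ≤ connProb p t :=
  randomMean_nonneg p fun G => by unfold connIndicator; split_ifs <;> norm_num

theorem compMean_nonneg (p : unitInterval) (n t : ℕ) : 0 ≤ compMean p n t := by
  have := connProb_nonneg p t
  have := sub_nonneg.2 p.2.2
  unfold compMean
  positivity

/-- Markov property of exploration: the component of `v` is `K` exactly when `v ∈ K`, `K` is a cut
and `K` induces a connected graph, and under the cut condition the graph outside `K` is independent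
of the one inside. Summing over `v` produces the factor |K|. -/
theorem randomMean_sum_compSet (p : unitInterval) (n : ℕ)
    (h : ∀ K : Set (Fin n), SimpleGraph ↥Kᶜ → ℝ) (γ : ℕ → ℝ)
    (hγ : ∀ K : Set (Fin n), randomMean ↥Kᶜ p (h K) = γ K.ncard) :
    randomMean (Fin n) p (fun G => ∑ v, h (G.compSet v) (G.induce (G.compSet v)ᶜ)) =
      ∑ t ∈ Finset.range (n + 1), compMean p n t * γ t := by
  classical
  have h1 : ∀ G : SimpleGraph (Fin n), ∑ v, h (G.compSet v) (G.induce (G.compSet v)ᶜ) =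
      ∑ K : Finset (Fin n), (K.card : ℝ) * (if G.IsCut (K : Set (Fin n)) then
        connIndicator (G.induce (K : Set (Fin n))) *
          h (K : Set (Fin n)) (G.induce (K : Set (Fin n))ᶜ) else 0) := by
    intro G
    have h2 : ∀ v, h (G.compSet v) (G.induce (G.compSet v)ᶜ) = ∑ K : Finset (Fin n),
        if G.compSet v = (K : Set (Fin n)) then
          h (K : Set (Fin n)) (G.induce (K : Set (Fin n))ᶜ) else 0 := by
      intro v
      obtain ⟨K, hK⟩ : ∃ K : Finset (Fin n), (K : Set (Fin n)) = G.compSet v :=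
        ⟨(Set.toFinite (G.compSet v)).toFinset, by simp⟩
      rw [← hK, Finset.sum_eq_single K, if_pos rfl]
      · intro L _ hL
        rw [if_neg fun h => hL (Finset.coe_injective h).symm]
      · simp
    simp only [h2]
    rw [Finset.sum_comm]
    refine Finset.sum_congr rfl fun K _ => ?_
    simp only [compSet_eq_iff, ite_and, Finset.mem_coe]
    rw [Finset.sum_ite_mem, Finset.univ_inter, Finset.sum_const, nsmul_eq_mul]
    congr 1
    unfold connIndicator
    split_ifs <;> simp
  simp only [h1]
  rw [randomMean_sum]
  have h3 : ∀ K : Finset (Fin n), randomMean (Fin n) p (fun G => (K.card : ℝ) *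
      (if G.IsCut (K : Set (Fin n)) then
        connIndicator (G.induce (K : Set (Fin n))) *
          h (K : Set (Fin n)) (G.induce (K : Set (Fin n))ᶜ) else 0)) =
      (fun t : ℕ => (t : ℝ) * ((1 - (p : ℝ)) ^ (t * (n - t)) * (connProb p t * γ t))) K.card := by
    intro K
    rw [randomMean_const_mul, randomMean_isCut (K : Set (Fin n)) p
      connIndicator (h K), hγ, Set.ncard_coe_finset]
    have hc : (K : Set (Fin n))ᶜ.ncard = n - K.card := by
      rw [Set.ncard_compl, Set.ncard_coe_finset, Nat.card_eq_fintype_card, Fintype.card_fin]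
    have hcp : randomMean (K : Set (Fin n)) p connIndicator =
        connProb p K.card := by
      have e : (K : Set (Fin n)) ≃ Fin K.card := by
        refine Finite.equivFinOfCardEq ?_
        rw [Nat.card_coe_set_eq, Set.ncard_coe_finset]
      rw [connProb, ← randomMean_equiv p e]
      simp only [connIndicator_equiv]
    rw [hc, hcp]
  rw [Finset.sum_congr rfl fun K _ => h3 K, ← Finset.powerset_univ,
    Finset.sum_powerset_apply_card
      (fun t : ℕ => (t : ℝ) * ((1 - (p : ℝ)) ^ (t * (n - t)) * (connProb p t * γ t))),
    Finset.card_univ, Fintype.card_fin]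
  refine Finset.sum_congr rfl fun t _ => ?_
  rw [nsmul_eq_mul, compMean]
  ring

theorem sum_compMean (p : unitInterval) (n : ℕ) :
    ∑ t ∈ Finset.range (n + 1), compMean p n t = n := by
  have := randomMean_sum_compSet p n (fun _ _ => 1) (fun _ => 1) (fun K => randomMean_const p 1)
  simpa [randomMean_const] using this.symm

/-- The expected number of vertices in components with at least `k` vertices. -/
noncomputable def bigMean (p : unitInterval) (k n : ℕ) : ℝ :=
  randomMean (Fin n) p fun G => (bigCount k G : ℝ)

/-- The probability that all components have fewer than `k` vertices. -/
noncomputable def noBigProb (p : unitInterval) (k n : ℕ) : ℝ :=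
  randomMean (Fin n) p (noBig k)

theorem bigMean_eq (p : unitInterval) (k n : ℕ) :
    bigMean p k n = ∑ t ∈ Finset.range (n + 1), compMean p n t * if k ≤ t then 1 else 0 := by
  rw [bigMean]
  simp only [bigCount_eq_sum]
  exact randomMean_sum_compSet p n (fun K _ => if k ≤ K.ncard then 1 else 0)
    (fun t => if k ≤ t then 1 else 0) (fun K => randomMean_const p _)

theorem noBigProb_le_one (p : unitInterval) (k n : ℕ) : noBigProb p k n ≤ 1 :=
  (randomMean_mono p (noBig_le_one k)).trans_eq (randomMean_const p 1)

theorem noBigProb_nonneg (p : unitInterval) (k n : ℕ) : 0 ≤ noBigProb p k n :=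
  randomMean_nonneg p (noBig_nonneg k)

/-- An equivalence of the complement of a set of `Fin n` with some `Fin k`. -/
noncomputable def complEquivFin {n : ℕ} (K : Set (Fin n)) : ↥Kᶜ ≃ Fin (n - K.ncard) := by
  refine Finite.equivFinOfCardEq ?_
  rw [Nat.card_coe_set_eq, Set.ncard_compl, Nat.card_eq_fintype_card, Fintype.card_fin]

theorem noBigProb_le (p : unitInterval) (k n : ℕ) :
    n * noBigProb p k n ≤ ∑ t ∈ Finset.range (n + 1),
      compMean p n t * ((if t < k then 1 else 0) * noBigProb p k (n - t)) := by
  classical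
  rw [← randomMean_sum_compSet p n (fun K H => (if K.ncard < k then 1 else 0) * noBig k H)
    (fun t => (if t < k then 1 else 0) * noBigProb p k (n - t)), noBigProb, ← randomMean_const_mul]
  · refine randomMean_mono p fun G => ?_
    simpa using noBig_le k G
  · intro K
    rw [randomMean_const_mul, noBigProb, ← randomMean_equiv p (complEquivFin K)]
    simp only [noBig_equiv]

theorem bigMean_le (p : unitInterval) (k n : ℕ) :
    bigMean p k n ≤ expectedLargestComponent n p + ∑ t ∈ Finset.range (n + 1),
      compMean p n t * ((if k ≤ t then 1 else 0) * bigMean p k (n - t)) := by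
  classical
  rw [← randomMean_sum_compSet p n (fun K H => (if k ≤ K.ncard then 1 else 0) * (bigCount k H : ℝ))
    (fun t => (if k ≤ t then 1 else 0) * bigMean p k (n - t)), bigMean, expectedLargestComponent,
    ← randomMean, ← randomMean_add]
  · refine randomMean_mono p fun G => ?_
    convert bigCount_le k G
  · intro K
    rw [randomMean_const_mul, bigMean, ← randomMean_equiv p (complEquivFin K)]
    simp only [bigCount_equiv]

theorem expectedLargestComponent_le (p : unitInterval) (k n : ℕ) :
    expectedLargestComponent n p ≤ bigMean p k n + k * noBigProb p k n := by
  rw [bigMean, noBigProb, expectedLargestComponent, ← randomMean, ← randomMean_const_mul,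
    ← randomMean_add]
  exact randomMean_mono p fun G => largestComponentSize_le k G

end SimpleGraph

/-! ### Estimates for logarithms and binomial coefficients. -/

theorem Real.add_sq_div_two_add_le_neg_log {x : ℝ} (h0 : 0 ≤ x) (h1 : x < 1) :
    x + x ^ 2 / 2 + x ^ 3 / 3 ≤ -Real.log (1 - x) := by
  have h := Real.hasSum_pow_div_log_of_abs_lt_one (x := x) (by rwa [abs_of_nonneg h0])
  have h2 := sum_le_hasSum (Finset.range 3) (fun i _ => by positivity) h
  norm_num [Finset.sum_range_succ] at h2
  linarith

theorem Real.one_sub_le_exp_neg_cubic {x : ℝ} (h0 : 0 ≤ x) (h1 : x < 1) :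
    1 - x ≤ Real.exp (-(x + x ^ 2 / 2 + x ^ 3 / 3)) := by
  rw [← Real.log_le_iff_le_exp (by linarith)]
  linarith [Real.add_sq_div_two_add_le_neg_log h0 h1]

theorem Real.exp_neg_add_sq_le {x : ℝ} (h0 : 0 ≤ x) (h1 : x ≤ 1 / 2) :
    Real.exp (-(x + x ^ 2)) ≤ 1 - x := by
  rw [← Real.le_log_iff_exp_le (by linarith)]
  have h4 := Real.abs_log_sub_add_sum_range_le (x := x) (by rw [abs_of_nonneg h0]; linarith) 2
  rw [abs_of_nonneg h0, abs_le] at h4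
  norm_num [Finset.sum_range_succ] at h4
  by_cases hx : x ≤ 1 / 3
  · have h6 : x ^ 3 / (1 - x) ≤ x ^ 2 / 2 := by
      rw [div_le_iff₀ (by linarith)]
      nlinarith [sq_nonneg x, mul_nonneg (sq_nonneg x) (by linarith : 0 ≤ 1 - 3 * x)]
    linarith
  -- The two-term remainder x³/(1-x) exceeds x²/2 once x > 1/3, so five terms of the series are used
  -- up to 1/2.
  · have h7 := Real.abs_log_sub_add_sum_range_le (x := x)
      (by rw [abs_of_nonneg h0]; linarith) 5
    rw [abs_of_nonneg h0, abs_le] at h7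
    norm_num [Finset.sum_range_succ] at h7
    have h8 : x ^ 6 / (1 - x) ≤ 2 * x ^ 6 := by
      rw [div_le_iff₀ (by linarith)]
      have : 0 ≤ x ^ 6 := by positivity
      nlinarith
    have h9 : x ^ 3 ≤ x ^ 2 / 2 := by nlinarith [sq_nonneg x]
    have h10 : x ^ 4 ≤ x ^ 2 / 4 := by nlinarith [sq_nonneg x]
    have h11 : x ^ 5 ≤ x ^ 2 / 8 := by nlinarith [sq_nonneg x]
    have h12 : x ^ 6 ≤ x ^ 2 / 16 := by nlinarith [sq_nonneg x]
    linarith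

theorem Real.exp_neg_add_cube_le {x : ℝ} (h0 : 0 ≤ x) (h1 : x ≤ 1 / 2) :
    Real.exp (-(x + x ^ 2 / 2 + 2 * x ^ 3)) ≤ 1 - x := by
  rw [← Real.le_log_iff_exp_le (by linarith)]
  have h := Real.abs_log_sub_add_sum_range_le (x := x) (by rw [abs_of_nonneg h0]; linarith) 2
  rw [abs_of_nonneg h0, abs_le] at h
  norm_num [Finset.sum_range_succ] at h
  have h2 : x ^ 3 / (1 - x) ≤ 2 * x ^ 3 := by
    rw [div_le_iff₀ (by linarith)]
    have : 0 ≤ x ^ 3 := by positivity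
    nlinarith
  linarith

/-- With w = (m-N+i)/m and δ = (N-n)/m this bounds (N-i)/(n-i), one factor of a ratio of binomial
coefficients, by an exponential whose main part is linear in i. -/
theorem Real.one_sub_le_mul_exp {w δ : ℝ} (hw : 0 ≤ w) (hδ : 0 ≤ δ) (h : w + δ ≤ 1 / 2) :
    1 - w ≤ (1 - (w + δ)) *
      Real.exp (δ + δ * w + δ ^ 2 / 2 + 2 * (w + δ) ^ 3) := by
  have h1 := Real.one_sub_le_exp_neg_cubic hw (by linarith)
  have h2 := Real.exp_neg_add_cube_le (x := w + δ) (by linarith) h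
  calc 1 - w ≤ Real.exp (-(w + w ^ 2 / 2)) :=
        h1.trans (Real.exp_le_exp.2 (by have : 0 ≤ w ^ 3 := by positivity
                                        linarith))
    _ = Real.exp (-(w + δ + (w + δ) ^ 2 / 2 + 2 * (w + δ) ^ 3)) *
        Real.exp (δ + δ * w + δ ^ 2 / 2 + 2 * (w + δ) ^ 3) := by
      rw [← Real.exp_add]
      ring_nf
    _ ≤ _ := mul_le_mul_of_nonneg_right h2 (Real.exp_pos _).le

theorem Nat.choose_mul_pow_le {n N : ℕ} (h : n ≤ N) (t : ℕ) :
    n.choose t * N ^ t ≤ N.choose t * n ^ t := by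
  have h1 : n.descFactorial t * N ^ t ≤ N.descFactorial t * n ^ t := by
    induction t with
    | zero => simp
    | succ t ih =>
      rw [Nat.descFactorial_succ, Nat.descFactorial_succ, pow_succ, pow_succ]
      have h2 : (n - t) * N ≤ (N - t) * n := by
        rw [Nat.sub_mul, Nat.sub_mul, mul_comm N n]
        exact Nat.sub_le_sub_left (Nat.mul_le_mul_left t h) _
      calc (n - t) * n.descFactorial t * (N ^ t * N)
          = (n.descFactorial t * N ^ t) * ((n - t) * N) := by ring
        _ ≤ (N.descFactorial t * n ^ t) * ((N - t) * n) := Nat.mul_le_mul ih h2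
        _ = _ := by ring
  rw [Nat.descFactorial_eq_factorial_mul_choose, Nat.descFactorial_eq_factorial_mul_choose,
    mul_assoc, mul_assoc] at h1
  exact Nat.le_of_mul_le_mul_left h1 t.factorial_pos

theorem Nat.choose_le_choose_mul_exp {n N t : ℕ} (α β : ℝ) (hβ : 0 ≤ β) (ht : t ≤ n) (hN : n ≤ N)
    (h : ∀ i : ℕ, i < t → (N : ℝ) - i ≤ (n - i) * Real.exp (α + β * i)) :
    (N.choose t : ℝ) ≤ n.choose t * Real.exp (t * α + β * t ^ 2 / 2) := by
  have h1 : (N.descFactorial t : ℝ) ≤ n.descFactorial t * Real.exp (t * α + β * t ^ 2 / 2) := by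
    induction t with
    | zero => simp
    | succ t ih =>
      have ih := ih (by omega) fun i hi => h i (by omega)
      have h2 := h t (by omega)
      rw [Nat.descFactorial_succ, Nat.descFactorial_succ, Nat.cast_mul, Nat.cast_mul,
        Nat.cast_sub (by omega), Nat.cast_sub (by omega)]
      have h3 : (0 : ℝ) ≤ N - t := by
        rw [sub_nonneg]
        exact_mod_cast (by omega : t ≤ N)
      have h4 : (0 : ℝ) ≤ n - t := by
        rw [sub_nonneg]
        exact_mod_cast (by omega : t ≤ n)
      calc ((N : ℝ) - t) * N.descFactorial t
          ≤ ((n - t) * Real.exp (α + β * t)) *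
            (n.descFactorial t * Real.exp (t * α + β * t ^ 2 / 2)) := by gcongr
        _ = ((n - t) * n.descFactorial t) *
            Real.exp (α + β * t + (t * α + β * t ^ 2 / 2)) := by
          rw [Real.exp_add (α + β * t)]
          ring
        _ ≤ _ := by
          refine mul_le_mul_of_nonneg_left (Real.exp_le_exp.2 ?_) (by positivity)
          push_cast
          nlinarith
  rw [Nat.descFactorial_eq_factorial_mul_choose, Nat.descFactorial_eq_factorial_mul_choose,
    Nat.cast_mul, Nat.cast_mul, mul_assoc] at h1
  exact le_of_mul_le_mul_left h1 (by exact_mod_cast t.factorial_pos)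

/-! ### Comparing component counts at two orders n ≤ N. -/

namespace SimpleGraph

variable {p : unitInterval}

theorem compMean_eq_zero {n t : ℕ} (h : n < t) : compMean p n t = 0 := by
  simp [compMean, Nat.choose_eq_zero_of_lt h]

theorem compMean_zero (n : ℕ) : compMean p n 0 = 0 := by
  simp [compMean]

theorem sum_compMean_of_lt {n L : ℕ} (h : n < L) : ∑ t ∈ Finset.range L, compMean p n t = n := by
  rw [← sum_compMean p n]
  symm
  refine Finset.sum_subset (Finset.range_subset_range.2 h) fun t _ ht => compMean_eq_zero ?_
  simp only [Finset.mem_range] at ht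
  omega

theorem sum_compMean_le (n L : ℕ) : ∑ t ∈ Finset.range L, compMean p n t ≤ n := by
  rw [← sum_compMean_of_lt (p := p) (show n < L + n + 1 by omega)]
  exact Finset.sum_le_sum_of_subset_of_nonneg (Finset.range_subset_range.2 (by omega))
    fun t _ _ => compMean_nonneg p n t

theorem bigMean_le_card (k n : ℕ) : bigMean p k n ≤ n := by
  rw [bigMean_eq]
  refine (Finset.sum_le_sum fun t _ => ?_).trans (sum_compMean_le (p := p) n (n + 1))
  have := compMean_nonneg p n t
  split_ifs <;> simp [this]

theorem bigMean_add_sum (k n : ℕ) :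
    bigMean p k n + ∑ t ∈ Finset.range (n + 1), compMean p n t * (if t < k then 1 else 0) = n := by
  rw [bigMean_eq, ← Finset.sum_add_distrib, ← sum_compMean p n]
  refine Finset.sum_congr rfl fun t _ => ?_
  rcases lt_or_ge t k with h | h
  · simp [h, h.not_ge]
  · simp [h, h.not_gt]

theorem compMean_le_exp_mul {n N : ℕ} (hnN : n ≤ N) (hN : 0 < N) (hp : (p : ℝ) < 1) {x : ℝ}
    (hx : (n : ℝ) ≤ N * (Real.exp x * (1 - (p : ℝ)) ^ (N - n))) (t : ℕ) :
    compMean p n t ≤ Real.exp (x * t) * compMean p N t := by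
  rcases lt_or_ge n t with h | h
  · rw [compMean_eq_zero h]
    exact mul_nonneg (Real.exp_pos _).le (compMean_nonneg _ _ _)
  have hq : 0 < 1 - (p : ℝ) := by linarith
  have hN' : (0 : ℝ) < N := by exact_mod_cast hN
  have hc := connProb_nonneg p t
  have h1 : (n.choose t : ℝ) * N ^ t ≤ N.choose t * n ^ t := by
    exact_mod_cast Nat.choose_mul_pow_le hnN t
  have h2 : (n : ℝ) ^ t ≤ N ^ t * (Real.exp (x * t) * (1 - (p : ℝ)) ^ (t * (N - n))) := by
    refine (pow_le_pow_left₀ (Nat.cast_nonneg n) hx t).trans_eq ?_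
    rw [mul_pow, mul_pow, ← Real.exp_nat_mul, mul_comm t (N - n), pow_mul, mul_comm x]
  have h3 : (n.choose t : ℝ) ≤
      Real.exp (x * t) * (N.choose t * (1 - (p : ℝ)) ^ (t * (N - n))) := by
    refine le_of_mul_le_mul_right (a := (N : ℝ) ^ t) ?_ (by positivity)
    calc _ ≤ (N.choose t : ℝ) * n ^ t := h1
      _ ≤ N.choose t * (N ^ t * (Real.exp (x * t) * (1 - (p : ℝ)) ^ (t * (N - n)))) := by gcongr
      _ = _ := by ring
  have h4 : t * (N - t) = t * (N - n) + t * (n - t) := by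
    rw [← mul_add]
    congr 1
    omega
  rw [compMean, compMean, h4, pow_add]
  calc _ ≤ Real.exp (x * t) * (N.choose t * (1 - (p : ℝ)) ^ (t * (N - n))) *
        (t * (connProb p t * (1 - (p : ℝ)) ^ (t * (n - t)))) := by gcongr
    _ = _ := by ring

theorem compMean_le_mul_exp {n N t : ℕ} (hnN : n ≤ N) (ht : t ≤ n) {x : ℝ}
    (hx : (N.choose t : ℝ) ≤ n.choose t * Real.exp (x + p * (t * (N - n)))) :
    compMean p N t ≤ compMean p n t * Real.exp x := by
  have hq : 0 ≤ 1 - (p : ℝ) := sub_nonneg.2 p.2.2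
  have hc := connProb_nonneg p t
  have h4 : t * (N - t) = t * (N - n) + t * (n - t) := by
    rw [← mul_add]
    congr 1
    omega
  have h5 : (1 - (p : ℝ)) ^ (t * (N - n)) ≤ Real.exp (-(p * (t * (N - n)))) := by
    have h6 : 1 - (p : ℝ) ≤ Real.exp (-p) := by linarith [Real.add_one_le_exp (-(p : ℝ))]
    refine (pow_le_pow_left₀ hq h6 _).trans_eq ?_
    rw [← Real.exp_nat_mul]
    push_cast [Nat.cast_sub hnN]
    ring_nf
  have h7 : (N.choose t : ℝ) * (1 - (p : ℝ)) ^ (t * (N - n)) ≤ n.choose t * Real.exp x := by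
    calc _ ≤ n.choose t * Real.exp (x + p * (t * (N - n))) *
          Real.exp (-(p * (t * (N - n)))) := by gcongr
      _ = _ := by
        rw [mul_assoc, ← Real.exp_add]
        ring_nf
  rw [compMean, compMean, h4, pow_add]
  calc _ = (N.choose t : ℝ) * (1 - (p : ℝ)) ^ (t * (N - n)) *
        (t * (connProb p t * (1 - (p : ℝ)) ^ (t * (n - t)))) := by ring
    _ ≤ n.choose t * Real.exp x *
        (t * (connProb p t * (1 - (p : ℝ)) ^ (t * (n - t)))) := by gcongr
    _ = _ := by ring

/-- A bound for the expected sum of the squared component sizes in the subcritical regime. -/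
theorem sum_mul_compMean_le {N : ℕ} (hN : 1 < (1 - N * (p : ℝ)) * (N + 1)) :
    (1 - N * (p : ℝ)) * ∑ t ∈ Finset.range (N + 1), t * compMean p N t ≤ N := by
  set b := 1 - N * (p : ℝ) with hb
  have hq : 0 ≤ 1 - (p : ℝ) := sub_nonneg.2 p.2.2
  have hb0 : 0 < b := by
    by_contra h
    have h1 : (0 : ℝ) ≤ N := Nat.cast_nonneg N
    nlinarith
  rcases Nat.eq_zero_or_pos N with rfl | hN0
  · simp [compMean_zero]
  have hN0' : (0 : ℝ) < N := by exact_mod_cast hN0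
  -- The second moment comes from perturbing N to N + 1: the exact ratio of counts is
  -- (N+1)(1-p)^t/(N+1-t), and the counts at order N + 1 have total N + 1.
  have hstep : ∀ t ∈ Finset.range (N + 1),
      compMean p N t * ((1 - p * t) / (N + 1 - t)) * (N + 1) ≤ compMean p (N + 1) t := by
    intro t ht
    have htN : t ≤ N := by simpa [Nat.lt_succ_iff] using ht
    have htN' : (t : ℝ) ≤ N := by exact_mod_cast htN
    have h0 : (0 : ℝ) < N + 1 - t := by linarith
    have h1 : ((N + 1).choose t : ℝ) * (N + 1 - t) = N.choose t * (N + 1) := by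
      have h3 := Nat.choose_mul_succ_eq N t
      have h4 : ((N + 1 - t : ℕ) : ℝ) = N + 1 - t := by
        rw [Nat.cast_sub (by omega)]
        push_cast
        ring
      rw [← h4]
      exact_mod_cast h3.symm
    have h5 : 1 - (p : ℝ) * t ≤ (1 - (p : ℝ)) ^ t := by
      have h6 := one_add_mul_le_pow (a := -(p : ℝ)) (by linarith [p.2.2]) t
      rw [← sub_eq_add_neg] at h6
      linarith
    have h6 : t * (N + 1 - t) = t * (N - t) + t := by
      rw [show N + 1 - t = (N - t) + 1 by omega, mul_add, mul_one]
    have hc := connProb_nonneg p t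
    have h7 : ((N + 1).choose t : ℝ) = N.choose t * (N + 1) / (N + 1 - t) := by
      rw [eq_div_iff h0.ne', h1]
    rw [compMean, compMean, h6, pow_add, h7]
    calc _ = (1 - (p : ℝ) * t) * ((N.choose t * (N + 1) / (N + 1 - t)) *
          (t * (connProb p t * (1 - (p : ℝ)) ^ (t * (N - t))))) := by
          field_simp
      _ ≤ (1 - (p : ℝ)) ^ t * ((N.choose t * (N + 1) / (N + 1 - t)) *
          (t * (connProb p t * (1 - (p : ℝ)) ^ (t * (N - t))))) := by gcongr
      _ = _ := by ring
  have hsum := (Finset.sum_le_sum hstep).trans (sum_compMean_le (p := p) (N + 1) (N + 1))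
  rw [← Finset.sum_mul] at hsum
  push_cast at hsum
  have hsum1 : ∑ t ∈ Finset.range (N + 1), compMean p N t * ((1 - p * t) / (N + 1 - t)) ≤ 1 :=
    le_of_mul_le_mul_right (by linarith) (by positivity : (0 : ℝ) < N + 1)
  have hd : 0 < (N : ℝ) + 1 - 1 / b := by
    rw [sub_pos, div_lt_iff₀ hb0]
    linarith
  have hpt : ∀ t ∈ Finset.range (N + 1),
      compMean p N t * ((t * b - 1) / (N * (N + 1 - 1 / b))) + compMean p N t / N ≤
        compMean p N t * ((1 - p * t) / (N + 1 - t)) := by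
    intro t ht
    have htN : t ≤ N := by simpa [Nat.lt_succ_iff] using ht
    have htN' : (t : ℝ) ≤ N := by exact_mod_cast htN
    have h0 : (0 : ℝ) < N + 1 - t := by linarith
    have h1 : (1 - (p : ℝ) * t) / (N + 1 - t) = (t * b - 1) / (N * (N + 1 - t)) + 1 / N := by
      rw [hb]
      field_simp
      ring
    rw [h1, mul_add, mul_one_div]
    -- The numerator changes sign at t = 1/b, so freezing the increasing factor 1/(N+1-t) at that
    -- point can only lower the product. What is left is linear in t.
    have h2 : (t * b - 1) / (N * (N + 1 - 1 / b)) ≤ (t * b - 1) / (N * (N + 1 - t)) := by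
      rw [div_le_div_iff₀ (by positivity) (by positivity)]
      have h3 : 0 ≤ (t * b - 1) * (t - 1 / b) := by
        have : (t * b - 1) * (t - 1 / b) = (t * b - 1) ^ 2 / b := by
          field_simp
        rw [this]
        positivity
      nlinarith
    gcongr
    exact compMean_nonneg p N t
  have h4 := (Finset.sum_le_sum hpt).trans hsum1
  rw [Finset.sum_add_distrib, ← Finset.sum_div, sum_compMean, div_self hN0'.ne'] at h4
  have h5 : ∑ t ∈ Finset.range (N + 1), compMean p N t * ((t * b - 1) / (N * (N + 1 - 1 / b))) =
      (b * ∑ t ∈ Finset.range (N + 1), t * compMean p N t - N) / (N * (N + 1 - 1 / b)) := by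
    rw [← sum_compMean p N, Finset.mul_sum, ← Finset.sum_sub_distrib, Finset.sum_div, sum_compMean]
    refine Finset.sum_congr rfl fun t _ => ?_
    ring
  rw [h5] at h4
  have h6 : (b * ∑ t ∈ Finset.range (N + 1), t * compMean p N t - N) / (N * (N + 1 - 1 / b)) ≤ 0 := by
    linarith
  rw [div_le_iff₀ (by positivity), zero_mul] at h6
  linarith

section NearCritical

variable {m : ℕ} {ε : ℝ}

/-- Per vertex, n/N costs about exp(-δ(1 + w + δ/2)) with δ = (N-n)/m, w = (m-N)/m, and dropping N -
n outside vertices gains about exp(δ(1+ε)). The 2/m absorbs the p² term. -/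
theorem compMean_le_exp_mul_of_near {n N : ℕ} (hp : (p : ℝ) = (1 + ε) / m) (hε : 0 ≤ ε)
    (hε1 : ε ≤ 1 / 4) (hm : 4 ≤ m) (hnN : n ≤ N) (hN : 0 < N) (hNm : N ≤ m) (t : ℕ) :
    compMean p n t ≤ Real.exp (((N : ℝ) - n) / m *
      (ε - (m - N) / m - (N - n) / (2 * m) + 2 / m) * t) * compMean p N t := by
  have hm' : (4 : ℝ) ≤ m := by exact_mod_cast hm
  have hm0 : (0 : ℝ) < m := by linarith
  have hN0 : (0 : ℝ) < N := by exact_mod_cast hN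
  have hNm' : (N : ℝ) ≤ m := by exact_mod_cast hNm
  have hnN' : (n : ℝ) ≤ N := by exact_mod_cast hnN
  have hp2 : (p : ℝ) ≤ 1 / 2 := by
    rw [hp, div_le_iff₀ hm0]
    linarith
  have hp0 : 0 ≤ (p : ℝ) := p.2.1
  refine compMean_le_exp_mul hnN hN (by linarith) ?_ t
  rcases Nat.eq_zero_or_pos n with rfl | hn
  · have : 0 ≤ 1 - (p : ℝ) := by linarith
    rw [Nat.cast_zero]
    positivity
  have hn0 : (0 : ℝ) < n := by exact_mod_cast hn
  have h1 : (n : ℝ) / N ≤ Real.exp (-((N - n) / N + ((N - n) / N) ^ 2 / 2)) := by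
    have h0 : 0 ≤ ((N : ℝ) - n) / N := div_nonneg (by linarith) hN0.le
    have h2 := Real.one_sub_le_exp_neg_cubic (x := ((N : ℝ) - n) / N) h0 (by
      rw [div_lt_one hN0]
      linarith)
    have h3 : 1 - ((N : ℝ) - n) / N = n / N := by
      field_simp
      ring
    rw [h3] at h2
    refine h2.trans (Real.exp_le_exp.2 ?_)
    have : 0 ≤ (((N : ℝ) - n) / N) ^ 3 := by positivity
    linarith
  have h4 : Real.exp (-((N - n) * (p + p ^ 2))) ≤ (1 - (p : ℝ)) ^ (N - n) := by
    refine le_trans (le_of_eq ?_) (pow_le_pow_left₀ (Real.exp_pos _).le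
      (Real.exp_neg_add_sq_le hp0 hp2) (N - n))
    rw [← Real.exp_nat_mul, Nat.cast_sub hnN]
    ring_nf
  rw [mul_comm, ← div_le_iff₀ hN0]
  refine h1.trans ?_
  refine le_trans ?_ (mul_le_mul_of_nonneg_left h4 (Real.exp_pos _).le)
  rw [← Real.exp_add, Real.exp_le_exp]
  have h5 : ((N : ℝ) - n) / m * (1 + (m - N) / m) ≤ (N - n) / N := by
    rw [div_mul_eq_mul_div, div_le_div_iff₀ hm0 hN0, mul_assoc]
    refine mul_le_mul_of_nonneg_left ?_ (by linarith)
    have : (1 + ((m : ℝ) - N) / m) * N = m - (m - N) ^ 2 / m := by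
      field_simp
      ring
    rw [this]
    have : 0 ≤ ((m : ℝ) - N) ^ 2 / m := by positivity
    linarith
  have h6 : ((N : ℝ) - n) / m ≤ (N - n) / N :=
    div_le_div_of_nonneg_left (by linarith) hN0 hNm'
  have h7 : 0 ≤ ((N : ℝ) - n) / m := div_nonneg (by linarith) hm0.le
  have h8 : (((N : ℝ) - n) / m) ^ 2 ≤ ((N - n) / N) ^ 2 := pow_le_pow_left₀ h7 h6 2
  have h9 : ((N : ℝ) - n) * (p + p ^ 2) ≤ (N - n) / m * (1 + ε + 2 / m) := by
    have : ((N : ℝ) - n) * (p + p ^ 2) = (N - n) / m * (1 + ε + (1 + ε) ^ 2 / m) := by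
      rw [hp]
      field_simp
    rw [this]
    gcongr
    nlinarith
  have h10 : ((N : ℝ) - n) / (2 * m) = (N - n) / m / 2 := by
    field_simp
  rw [h10]
  nlinarith

/-- Reverse comparison. The term t/(2m) appears because the ratio of binomial coefficients differs
from (N/n)^t by a factor quadratic in t in the exponent. -/
theorem compMean_le_mul_exp_of_near {n N t : ℕ} (hp : (p : ℝ) = (1 + ε) / m) (hm : 0 < m)
    (hnN : n ≤ N) (hNm : N ≤ m) (ht : t ≤ n) (hu : ((m : ℝ) - n + t) / m ≤ 1 / 2) :
    compMean p N t ≤ compMean p n t * Real.exp (t * (((N : ℝ) - n) / m *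
      ((m - N) / m + (N - n) / (2 * m) + t / (2 * m) - ε) + 2 * ((m - n + t) / m) ^ 3)) := by
  have hm0 : (0 : ℝ) < m := by exact_mod_cast hm
  have hNm' : (N : ℝ) ≤ m := by exact_mod_cast hNm
  have hnN' : (n : ℝ) ≤ N := by exact_mod_cast hnN
  refine compMean_le_mul_exp hnN ht ?_
  have h := Nat.choose_le_choose_mul_exp (n := n) (N := N) (t := t)
    (((N : ℝ) - n) / m * (1 + (m - N) / m + (N - n) / (2 * m)) + 2 * ((m - n + t) / m) ^ 3)
    (((N : ℝ) - n) / m ^ 2) (div_nonneg (by linarith) (by positivity)) ht hnN ?_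
  · refine h.trans_eq ?_
    rw [hp]
    congr 2
    field_simp
    ring
  · intro i hi
    have hi' : (i : ℝ) ≤ t := by exact_mod_cast hi.le
    have hi0 : (0 : ℝ) ≤ i := Nat.cast_nonneg i
    have hw : 0 ≤ ((m : ℝ) - N + i) / m := div_nonneg (by linarith) hm0.le
    have hδ : 0 ≤ ((N : ℝ) - n) / m := div_nonneg (by linarith) hm0.le
    have hs : ((m : ℝ) - N + i) / m + (N - n) / m = (m - n + i) / m := by ring
    have hs2 : ((m : ℝ) - n + i) / m ≤ (m - n + t) / m := by gcongr
    have h1 := Real.one_sub_le_mul_exp hw hδ (by rw [hs]; linarith)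
    rw [hs] at h1
    have h2 : 1 - ((m : ℝ) - N + i) / m = (N - i) / m := by
      field_simp
      ring
    have h3 : 1 - ((m : ℝ) - n + i) / m = (n - i) / m := by
      field_simp
      ring
    rw [h2, h3, div_mul_eq_mul_div, div_le_div_iff_of_pos_right hm0] at h1
    refine h1.trans (mul_le_mul_of_nonneg_left (Real.exp_le_exp.2 ?_) ?_)
    · have h4 : (((m : ℝ) - n + i) / m) ^ 3 ≤ ((m - n + t) / m) ^ 3 := by
        refine pow_le_pow_left₀ (div_nonneg (by linarith) hm0.le) hs2 3
      have h5 : ((N : ℝ) - n) / m * (1 + (m - N) / m + (N - n) / (2 * m)) +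
          (N - n) / m ^ 2 * i = (N - n) / m + (N - n) / m * ((m - N + i) / m) +
            ((N - n) / m) ^ 2 / 2 := by
        field_simp
        ring
      linarith
    · have : (t : ℝ) ≤ n := by exact_mod_cast ht
      linarith

end NearCritical

end SimpleGraph

/-! ### Bounds near criticality. -/

namespace SimpleGraph

variable {p : unitInterval} {m : ℕ} {ε : ℝ}

theorem mul_add_cube_le_neg_sq {ε δ B u : ℝ} (hε : 0 < ε) (hε1 : ε ≤ 1 / 1000) (hδ : ε / 8 ≤ δ)
    (hB : B ≤ -(ε / 4)) (hu0 : 0 ≤ u) (hu : u ≤ 2 * ε) :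
    δ * B + 2 * u ^ 3 ≤ -(ε ^ 2 / 80) := by
  have h1 : u ^ 3 ≤ (2 * ε) ^ 3 := pow_le_pow_left₀ hu0 hu 3
  have h2 : ε ^ 3 ≤ ε ^ 2 / 1000 := by nlinarith [sq_nonneg ε]
  have h3 : δ * B ≤ ε / 8 * -(ε / 4) := by nlinarith
  linarith [sq_nonneg ε]

theorem exists_nat_div_mem {m : ℕ} (hm : 0 < m) {x : ℝ} (hx : 0 ≤ x) :
    ∃ d : ℕ, x - 1 / m ≤ (d : ℝ) / m ∧ (d : ℝ) / m ≤ x := by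
  have hm0 : (0 : ℝ) < m := by exact_mod_cast hm
  refine ⟨⌊x * m⌋₊, ?_, ?_⟩
  · rw [sub_le_iff_le_add, ← add_div, le_div_iff₀ hm0]
    exact (Nat.lt_floor_add_one _).le
  · rw [div_le_iff₀ hm0]
    exact Nat.floor_le (by positivity)

/-- Below the critical order, comparison with n + d for d ≈ εm/4 gains a factor exponentially small
in t, at least ε/16 · ε/8 per vertex in the exponent; the counts at order n + d have total at most
m. -/
theorem bigMean_le_exp (hp : (p : ℝ) = (1 + ε) / m) (hm : 4 ≤ m) (hε : 0 < ε)
    (hε1 : ε ≤ 1 / 1000) (hH : 1000 ≤ ε ^ 3 * m) {n : ℕ} (k : ℕ) (hn : 5 / 4 * ε ≤ (m - n) / m) :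
    bigMean p k n ≤ m * Real.exp (-(ε ^ 2 * k / 128)) := by
  have hm0 : (0 : ℝ) < m := by exact_mod_cast (by omega : 0 < m)
  have hr : 1 / (m : ℝ) ≤ ε ^ 3 / 1000 := by
    rw [div_le_iff₀ hm0]
    linarith
  have hr2 : 1 / (m : ℝ) ≤ ε / 1000 := hr.trans (by nlinarith [sq_nonneg ε])
  obtain ⟨d, hd1, hd2⟩ := exists_nat_div_mem (m := m) (by omega) (x := ε / 4) (by positivity)
  have hd0 : 0 < d := by
    rw [Nat.pos_iff_ne_zero]
    rintro rfl
    rw [Nat.cast_zero, zero_div] at hd1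
    linarith
  have hw : ((m : ℝ) - n) / m - d / m = (m - (n + d : ℕ)) / m := by
    push_cast
    ring
  have hNm : n + d ≤ m := by
    have h : (0 : ℝ) ≤ (m - (n + d : ℕ)) / m := by
      rw [← hw]
      linarith
    rw [le_div_iff₀ hm0, zero_mul, sub_nonneg] at h
    exact_mod_cast h
  rw [bigMean_eq]
  have hX : ((n + d : ℕ) - n : ℝ) / m * (ε - (m - (n + d : ℕ)) / m - ((n + d : ℕ) - n) / (2 * m) +
      2 / m) ≤ -(ε ^ 2 / 128) := by
    have e1 : ((n + d : ℕ) - n : ℝ) / m = d / m := by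
      push_cast
      ring
    have e2 : ((n + d : ℕ) - n : ℝ) / (2 * m) = d / m / 2 := by
      push_cast
      field_simp
      ring
    have e3 : (2 : ℝ) / m = 2 * (1 / m) := by ring
    rw [e1, e2, e3, ← hw]
    have h1 : ε - ((m - n) / m - d / m) - d / m / 2 + 2 * (1 / m) ≤ -(ε / 16) := by linarith
    have h2 : ε / 8 ≤ d / m := by linarith
    nlinarith
  calc _ ≤ ∑ t ∈ Finset.range (n + 1), Real.exp (-(ε ^ 2 * k / 128)) * compMean p (n + d) t := by
        refine Finset.sum_le_sum fun t _ => ?_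
        have h0 := compMean_nonneg p (n + d) t
        split_ifs with hk
        · rw [mul_one]
          refine (compMean_le_exp_mul_of_near hp hε.le (by linarith) hm (Nat.le_add_right n d)
            (by omega) hNm t).trans ?_
          gcongr
          have hk' : (k : ℝ) ≤ t := by exact_mod_cast hk
          have ht : (0 : ℝ) ≤ t := Nat.cast_nonneg t
          linarith [mul_le_mul_of_nonneg_right hX ht, mul_le_mul_of_nonneg_left hk' (sq_nonneg ε)]
        · rw [mul_zero]
          positivity
    _ ≤ Real.exp (-(ε ^ 2 * k / 128)) * m := by
        rw [← Finset.mul_sum]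
        refine mul_le_mul_of_nonneg_left ((sum_compMean_le _ _).trans ?_) (Real.exp_pos _).le
        exact_mod_cast hNm
    _ = _ := mul_comm _ _

/-- Strong induction on `n` through `noBigProb_le`. Removing a component of order t weakens the
inductive bound by exp(ε²t/80), and replacing the count at order n by the one at n - d, d ≈ εm/4,
regains exactly that factor because n is supercritical. The remaining counts sum to n - d ≤ n. -/
theorem noBigProb_le_exp (hp : (p : ℝ) = (1 + ε) / m) (hm : 4 ≤ m) (hε : 0 < ε)
    (hε1 : ε ≤ 1 / 1000) (hH : 1000 ≤ ε ^ 3 * m) {k : ℕ}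
    (hk : ∀ t : ℕ, t < k → (t : ℝ) / m ≤ ε / 10) (n : ℕ) (hn : n ≤ m) :
    noBigProb p k n ≤ Real.exp (-(ε ^ 2 / 80 * (n - m * (1 - ε / 2)))) := by
  have hm0 : (0 : ℝ) < m := by exact_mod_cast (by omega : 0 < m)
  have hr : 1 / (m : ℝ) ≤ ε ^ 3 / 1000 := by
    rw [div_le_iff₀ hm0]
    linarith
  have hr2 : 1 / (m : ℝ) ≤ ε / 1000 := hr.trans (by nlinarith [sq_nonneg ε])
  obtain ⟨d, hd1, hd2⟩ := exists_nat_div_mem (m := m) (by omega) (x := ε / 4) (by positivity)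
  induction n using Nat.strong_induction_on with
  | _ n ih =>
  rcases le_total (n : ℝ) (m * (1 - ε / 2)) with hle | hge
  · refine (noBigProb_le_one p k n).trans (Real.one_le_exp ?_)
    have : 0 ≤ ε ^ 2 / 80 * (m * (1 - ε / 2) - n) := by
      have := sub_nonneg.2 hle
      positivity
    linarith
  have hnm : ((m : ℝ) - n) / m ≤ ε / 2 := by
    rw [div_le_iff₀ hm0]
    linarith
  have hnm0 : 0 ≤ ((m : ℝ) - n) / m := by
    refine div_nonneg (sub_nonneg.2 ?_) hm0.le
    exact_mod_cast hn
  have hdn : d + 0 ≤ n := by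
    have h1 : (d : ℝ) ≤ ε / 4 * m := by rwa [div_le_iff₀ hm0] at hd2
    have h2 : (d : ℝ) ≤ n := by nlinarith
    exact_mod_cast h2
  obtain ⟨n', rfl⟩ : ∃ n', n = n' + d := ⟨n - d, by omega⟩
  have hw : ((m : ℝ) - n') / m = (m - (n' + d : ℕ)) / m + d / m := by
    push_cast
    ring
  have hstep : ∀ t ∈ Finset.range (n' + d + 1),
      compMean p (n' + d) t * ((if t < k then 1 else 0) * noBigProb p k (n' + d - t)) ≤
        Real.exp (-(ε ^ 2 / 80 * ((n' + d : ℕ) - m * (1 - ε / 2)))) * compMean p n' t := by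
    intro t ht
    have h0 := compMean_nonneg p n' t
    rcases Nat.eq_zero_or_pos t with rfl | ht0
    · simp [compMean_zero]
    have ht : t ≤ n' + d := by simpa [Nat.lt_succ_iff] using ht
    split_ifs with htk
    · have htm := hk t htk
      have ht0' : (0 : ℝ) ≤ t := Nat.cast_nonneg t
      have htm0 : 0 ≤ (t : ℝ) / m := by positivity
      have htn' : t ≤ n' := by
        have h1 : ((t : ℝ) - n') / m ≤ 0 := by
          have : ((t : ℝ) - n') / m = t / m + (m - n') / m - 1 := by
            field_simp
            ring
          rw [this]
          linarith
        rw [div_le_iff₀ hm0, zero_mul, sub_nonpos] at h1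
        exact_mod_cast h1
      have hut : ((m : ℝ) - n' + t) / m = (m - n') / m + t / m := by ring
      have h1 := compMean_le_mul_exp_of_near (N := n' + d) hp (by omega) (Nat.le_add_right n' d) hn
        htn' (by rw [hut]; linarith)
      have h2 := ih (n' + d - t) (by omega) (by omega)
      have h3 : ((n' + d - t : ℕ) : ℝ) = (n' + d : ℕ) - t := Nat.cast_sub ht
      rw [h3] at h2
      rw [one_mul]
      refine (mul_le_mul h1 h2 (noBigProb_nonneg _ _ _) (by positivity)).trans ?_
      rw [mul_assoc, ← Real.exp_add, mul_comm]
      refine mul_le_mul_of_nonneg_right (Real.exp_le_exp.2 ?_) h0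
      have e1 : ((n' + d : ℕ) - n' : ℝ) / m = d / m := by
        push_cast
        ring
      have e2 : ((n' + d : ℕ) - n' : ℝ) / (2 * m) = d / m / 2 := by
        push_cast
        field_simp
        ring
      have e4 : (t : ℝ) / (2 * m) = t / m / 2 := by
        field_simp
      rw [e1, e2, e4, hut]
      have h10 := mul_add_cube_le_neg_sq (δ := d / m)
        (B := (m - (n' + d : ℕ)) / m + d / m / 2 + t / m / 2 - ε)
        (u := ((m : ℝ) - n') / m + t / m) hε hε1 (by linarith) (by linarith)
        (by rw [hw]; positivity) (by linarith)
      have h11 := mul_le_mul_of_nonneg_left h10 ht0'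
      refine (add_le_add_left h11 _).trans (le_of_eq ?_)
      ring
    · rw [zero_mul, mul_zero]
      positivity
  have h1 := (noBigProb_le p k (n' + d)).trans (Finset.sum_le_sum hstep)
  rw [← Finset.mul_sum, sum_compMean_of_lt (by omega)] at h1
  have hpos : (0 : ℝ) < (n' + d : ℕ) := by
    have : 0 < m * (1 - ε / 2) := mul_pos hm0 (by linarith)
    linarith
  refine le_of_mul_le_mul_left (h1.trans ?_) hpos
  rw [mul_comm]
  gcongr
  omega

/-- Two big components are unlikely: if the first has at least 5εm/4 vertices, the rest is
subcritical and `bigMean_le_exp` applies; if its order lies between k and 5εm/4, its own expected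
count is exponentially small by comparison with order m - d. -/
theorem sum_compMean_mul_bigMean_le (hp : (p : ℝ) = (1 + ε) / m) (hm : 4 ≤ m) (hε : 0 < ε)
    (hε1 : ε ≤ 1 / 1000) (hH : 1000 ≤ ε ^ 3 * m) (k : ℕ) :
    ∑ t ∈ Finset.range (m + 1), compMean p m t * ((if k ≤ t then 1 else 0) * bigMean p k (m - t)) ≤
      2 * m ^ 2 * Real.exp (-(ε ^ 2 * k / 128)) := by
  have hm0 : (0 : ℝ) < m := by exact_mod_cast (by omega : 0 < m)
  have hr : 1 / (m : ℝ) ≤ ε ^ 3 / 1000 := by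
    rw [div_le_iff₀ hm0]
    linarith
  have hr2 : 1 / (m : ℝ) ≤ ε / 1000 := hr.trans (by nlinarith [sq_nonneg ε])
  obtain ⟨d, hd1, hd2⟩ := exists_nat_div_mem (m := m) (by omega) (x := ε / 4) (by positivity)
  have hdm : d ≤ m := by
    have h1 : (d : ℝ) ≤ ε / 4 * m := by rwa [div_le_iff₀ hm0] at hd2
    have h2 : (d : ℝ) ≤ m := by nlinarith
    exact_mod_cast h2
  have hn : ((m - d : ℕ) : ℝ) = m - d := Nat.cast_sub hdm
  have hstep : ∀ t ∈ Finset.range (m + 1),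
      compMean p m t * ((if k ≤ t then 1 else 0) * bigMean p k (m - t)) ≤
        m * Real.exp (-(ε ^ 2 * k / 128)) * (compMean p m t + compMean p (m - d) t) := by
    intro t ht
    have ht : t ≤ m := by simpa [Nat.lt_succ_iff] using ht
    have h0 := compMean_nonneg p (m - d) t
    have h0' := compMean_nonneg p m t
    split_ifs with hkt
    · rw [one_mul]
      have hbm := bigMean_le_card (p := p) k (m - t)
      have hcast : ((m - t : ℕ) : ℝ) = m - t := Nat.cast_sub ht
      have ht0' : (0 : ℝ) ≤ t := Nat.cast_nonneg t
      rcases le_total (5 / 4 * ε) ((t : ℝ) / m) with hlarge | hsmall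
      · have h1 := bigMean_le_exp (n := m - t) hp hm hε hε1 hH k (by rw [hcast, sub_sub_cancel]; exact hlarge)
        calc _ ≤ compMean p m t * (m * Real.exp (-(ε ^ 2 * k / 128))) := by gcongr
          _ ≤ (compMean p m t + compMean p (m - d) t) * (m * Real.exp (-(ε ^ 2 * k / 128))) := by
            gcongr
            linarith
          _ = _ := mul_comm _ _
      · have htn : t ≤ m - d := by
          have h1 : ((t : ℝ) + d) / m ≤ 1 := by
            rw [add_div]
            linarith
          rw [div_le_one hm0] at h1
          have : t + d ≤ m := by exact_mod_cast h1
          omega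
        have htm0 : 0 ≤ (t : ℝ) / m := by positivity
        have hut : ((m : ℝ) - (m - d : ℕ) + t) / m = d / m + t / m := by
          rw [hn]
          ring
        have h1 := compMean_le_mul_exp_of_near (N := m) hp (by omega) (Nat.sub_le m d) le_rfl htn
          (by rw [hut]; linarith)
        have hX : ((m : ℝ) - (m - d : ℕ)) / m * ((m - m) / m + (m - (m - d : ℕ)) / (2 * m) +
            t / (2 * m) - ε) + 2 * ((m - (m - d : ℕ) + t) / m) ^ 3 ≤ -(ε ^ 2 / 128) := by
          have e1 : ((m : ℝ) - (m - d : ℕ)) / m = d / m := by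
            rw [hn]
            ring
          have e2 : ((m : ℝ) - (m - d : ℕ)) / (2 * m) = d / m / 2 := by
            rw [hn]
            field_simp
            ring
          have e4 : (t : ℝ) / (2 * m) = t / m / 2 := by
            field_simp
          rw [hut, e1, e2, e4, sub_self, zero_div]
          have := mul_add_cube_le_neg_sq (δ := d / m) (B := 0 + (d : ℝ) / m / 2 + t / m / 2 - ε)
            (u := (d : ℝ) / m + t / m) hε hε1 (by linarith) (by linarith) (by positivity)
            (by linarith)
          linarith [sq_nonneg ε]
        have h2 : compMean p m t ≤ compMean p (m - d) t * Real.exp (-(ε ^ 2 * k / 128)) := by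
          refine h1.trans (mul_le_mul_of_nonneg_left (Real.exp_le_exp.2 ?_) h0)
          have hk' : (k : ℝ) ≤ t := by exact_mod_cast hkt
          linarith [mul_le_mul_of_nonneg_left hX ht0', mul_le_mul_of_nonneg_left hk' (sq_nonneg ε)]
        have h3 : bigMean p k (m - t) ≤ m := hbm.trans (by exact_mod_cast Nat.sub_le m t)
        calc _ ≤ compMean p (m - d) t * Real.exp (-(ε ^ 2 * k / 128)) * m := by
              refine mul_le_mul h2 h3 ?_ (by positivity)
              exact randomMean_nonneg p fun G => Nat.cast_nonneg _
          _ ≤ (compMean p m t + compMean p (m - d) t) * Real.exp (-(ε ^ 2 * k / 128)) * m := by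
            gcongr
            linarith
          _ = _ := by ring
    · rw [zero_mul, mul_zero]
      positivity
  refine (Finset.sum_le_sum hstep).trans ?_
  rw [← Finset.mul_sum, Finset.sum_add_distrib]
  have h1 := sum_compMean_le (p := p) m (m + 1)
  have h2 := sum_compMean_le (p := p) (m - d) (m + 1)
  rw [hn] at h2
  have hd0 : (0 : ℝ) ≤ d := Nat.cast_nonneg d
  calc _ ≤ m * Real.exp (-(ε ^ 2 * k / 128)) * (m + m) := by
        gcongr
        linarith
    _ = _ := by ring

theorem bigMean_le_upper (hp : (p : ℝ) = (1 + ε) / m) (hm : 4 ≤ m) (hε : 0 < ε)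
    (hε1 : ε ≤ 1 / 1000) (hH : 1000 ≤ ε ^ 3 * m) (k : ℕ) :
    bigMean p k m ≤ 2 * ε * m - 8 / 3 * ε ^ 2 * m + 16 * (ε ^ 3 * m) + 1 +
      m * Real.exp (-(ε ^ 2 * k / 128)) := by
  have hm0 : (0 : ℝ) < m := by exact_mod_cast (by omega : 0 < m)
  have hr : 1 / (m : ℝ) ≤ ε ^ 3 / 1000 := by
    rw [div_le_iff₀ hm0]
    linarith
  have hr2 : 1 / (m : ℝ) ≤ ε / 1000 := hr.trans (by nlinarith [sq_nonneg ε])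
  have he2 : ε ^ 2 ≤ ε / 1000 := by nlinarith
  have he3 : ε ^ 3 ≤ ε / 1000 := by nlinarith [sq_nonneg ε]
  have he30 : 0 < ε ^ 3 := by positivity
  -- The survival equation 1 - y = exp(-(1+ε)y) reads y/2 + y²/3 + … = ε after taking logarithms,
  -- with root 2ε - (8/3)ε² + O(ε³). The term 16ε³ leaves room for the p² correction and the
  -- truncation.
  set x := 2 * ε - 8 / 3 * ε ^ 2 + 16 * ε ^ 3 with hx
  have hx0 : 3 / 2 * ε ≤ x := by
    rw [hx]
    linarith
  obtain ⟨d, hd1, hd2⟩ := exists_nat_div_mem (m := m) (by omega) (x := x + 1 / m)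
    (by have : 0 < 1 / (m : ℝ) := by positivity
        linarith)
  rw [add_sub_cancel_right] at hd1
  have hd3 : (d : ℝ) / m ≤ 3 * ε := by linarith [sq_nonneg ε]
  have hdm : d < m := by
    have h1 : (d : ℝ) ≤ 3 * ε * m := by rwa [div_le_iff₀ hm0] at hd3
    have h2 : (d : ℝ) < m := by nlinarith
    exact_mod_cast h2
  have hn : ((m - d : ℕ) : ℝ) = m - d := Nat.cast_sub hdm.le
  have hp0 : 0 ≤ (p : ℝ) := p.2.1
  have hpr : (p : ℝ) = (1 + ε) * (1 / m) := by rw [hp]; ring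
  have hp3 : (p : ℝ) ≤ 2 * (1 / m) := by
    rw [hpr]
    gcongr
    linarith
  have hp2 : (p : ℝ) ≤ 1 / 2 := by linarith
  have hcond : ((m - d : ℕ) : ℝ) ≤ m * (Real.exp 0 * (1 - (p : ℝ)) ^ (m - (m - d))) := by
    rw [Real.exp_zero, one_mul, mul_comm, ← div_le_iff₀ hm0, Nat.sub_sub_self hdm.le, hn]
    have h1 : ((m : ℝ) - d) / m = 1 - d / m := by
      field_simp
    rw [h1]
    set y := (d : ℝ) / m with hy
    have hy0 : 0 ≤ y := by positivity
    refine (Real.one_sub_le_exp_neg_cubic hy0 (by linarith)).trans ?_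
    refine le_trans ?_ (pow_le_pow_left₀ (Real.exp_pos _).le (Real.exp_neg_add_sq_le hp0 hp2) d)
    rw [← Real.exp_nat_mul, Real.exp_le_exp]
    have h2 : (d : ℝ) * -(p + p ^ 2) = -(y * ((1 + ε) * (1 + p))) := by
      rw [hy, hpr]
      field_simp
    rw [h2]
    have h3 : y + y ^ 2 / 2 + y ^ 3 / 3 = y * (1 + y / 2 + y ^ 2 / 3) := by ring
    rw [h3, neg_le_neg_iff]
    refine mul_le_mul_of_nonneg_left ?_ hy0
    have h4 : x / 2 + x ^ 2 / 3 ≤ y / 2 + y ^ 2 / 3 := by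
      have : x ^ 2 ≤ y ^ 2 := pow_le_pow_left₀ (by linarith) hd1 2
      linarith
    have h5 : 4 * ε ^ 2 - 32 / 3 * ε ^ 3 ≤ x ^ 2 := by
      have h6 : 2 * ε - 8 / 3 * ε ^ 2 ≤ x := by
        rw [hx]
        linarith
      have h7 : 0 ≤ 2 * ε - 8 / 3 * ε ^ 2 := by linarith
      have h8 := pow_le_pow_left₀ h7 h6 2
      nlinarith [sq_nonneg (ε ^ 2)]
    have h9 : (1 + ε) * (1 + p) ≤ 1 + ε + ε ^ 3 := by nlinarith
    have h10 : x / 2 = ε - 4 / 3 * ε ^ 2 + 8 * ε ^ 3 := by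
      rw [hx]
      ring
    linarith
  -- Exponent 0: the comparison holds for all t at once, with no loss.
  have hcomp : ∀ t, compMean p (m - d) t ≤ compMean p m t := fun t => by
    have := compMean_le_exp_mul (Nat.sub_le m d) (by omega) (by linarith) hcond t
    rwa [zero_mul, Real.exp_zero, one_mul] at this
  have h1 := bigMean_add_sum (p := p) k m
  have h2 := bigMean_add_sum (p := p) k (m - d)
  have h3 : ∑ t ∈ Finset.range (m - d + 1), compMean p (m - d) t * (if t < k then 1 else 0) ≤
      ∑ t ∈ Finset.range (m + 1), compMean p m t * (if t < k then 1 else 0) := by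
    refine (Finset.sum_le_sum fun t _ => ?_).trans (Finset.sum_le_sum_of_subset_of_nonneg
      (Finset.range_subset_range.2 (by omega)) fun t _ _ => ?_)
    · exact mul_le_mul_of_nonneg_right (hcomp t) (by split_ifs <;> norm_num)
    · have := compMean_nonneg p m t
      split_ifs <;> simp [this]
  have h4 := bigMean_le_exp (n := m - d) hp hm hε hε1 hH k (by
    rw [hn, sub_sub_cancel]
    linarith)
  have h5 : (d : ℝ) ≤ x * m + 1 := by
    rw [div_le_iff₀ hm0, add_mul, one_div_mul_cancel hm0.ne'] at hd2
    exact hd2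
  rw [hn] at h2
  have h6 : x * m = 2 * ε * m - 8 / 3 * ε ^ 2 * m + 16 * (ε ^ 3 * m) := by
    rw [hx]
    ring
  linarith

theorem compMean_le_exp_neg_mul (hp : (p : ℝ) = (1 + ε) / m) (hm : 4 ≤ m) (hε : 0 < ε)
    (hε1 : ε ≤ 1 / 1000) (hr : 1 / (m : ℝ) ≤ ε / 1000) {n e : ℕ}
    (hn : 2 * ε - 40 * ε ^ 2 - 1 / m ≤ (m - n) / m) (hN0 : 0 < n + e) (hN : n + e ≤ m)
    (he1 : ε / 2 - 1 / m ≤ (e : ℝ) / m) (he2 : (e : ℝ) / m ≤ ε / 2) (t : ℕ) :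
    compMean p n t ≤ Real.exp (-(3 / 10 * ε ^ 2 * t)) * compMean p (n + e) t := by
  have h0 := compMean_nonneg p (n + e) t
  refine (compMean_le_exp_mul_of_near hp hε.le (by linarith) hm (Nat.le_add_right _ e)
    hN0 hN t).trans (mul_le_mul_of_nonneg_right (Real.exp_le_exp.2 ?_) h0)
  have e1 : (((n + e : ℕ) : ℝ) - n) / m = e / m := by
    push_cast
    ring
  have e2 : (((n + e : ℕ) : ℝ) - n) / (2 * m) = e / m / 2 := by
    push_cast
    field_simp
    ring
  have e3 : (2 : ℝ) / m = 2 * (1 / m) := by ring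
  have e4 : ((m : ℝ) - (n + e : ℕ)) / m = (m - n) / m - e / m := by
    push_cast
    ring
  rw [e1, e2, e3, e4, ← neg_mul]
  refine mul_le_mul_of_nonneg_right ?_ (Nat.cast_nonneg t)
  have he2 : ε ^ 2 ≤ ε / 1000 := by nlinarith
  have h1 : ε - ((m - n) / m - e / m) - e / m / 2 + 2 * (1 / m) ≤ -(7 / 10 * ε) := by linarith
  have h2 : 49 / 100 * ε ≤ e / m := by linarith
  nlinarith

/-- Stopping 40ε² short of 2ε makes y(y/2 - ε) at most -20ε³ for y = (m-n)/m, which outweighs the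
cubic error 2(2.1ε)³. Only the part quadratic in t survives. -/
theorem compMean_le_mul_exp_sq (hp : (p : ℝ) = (1 + ε) / m) (hm : 4 ≤ m) (hε : 0 < ε)
    (hε1 : ε ≤ 1 / 1000) {n t : ℕ} (hn1 : ε ≤ (m - n) / m)
    (hn2 : ((m : ℝ) - n) / m ≤ 2 * ε - 40 * ε ^ 2) (hnm : n ≤ m) (ht : (t : ℝ) / m ≤ ε / 10) :
    compMean p m t ≤ compMean p n t * Real.exp (t * (ε * (t / m))) := by
  have hm0 : (0 : ℝ) < m := by exact_mod_cast (by omega : 0 < m)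
  have hsq := sq_nonneg ε
  have ht0 : 0 ≤ (t : ℝ) / m := by positivity
  have htn : t ≤ n := by
    have h1 : ((t : ℝ) - n) / m ≤ 0 := by
      have : ((t : ℝ) - n) / m = t / m + (m - n) / m - 1 := by
        field_simp
        ring
      rw [this]
      linarith
    rw [div_le_iff₀ hm0, zero_mul, sub_nonpos] at h1
    exact_mod_cast h1
  have hut : ((m : ℝ) - n + t) / m = (m - n) / m + t / m := by ring
  refine (compMean_le_mul_exp_of_near (N := m) hp (by omega) hnm le_rfl htn
    (by rw [hut]; linarith)).trans (mul_le_mul_of_nonneg_left (Real.exp_le_exp.2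
      (mul_le_mul_of_nonneg_left ?_ (Nat.cast_nonneg t))) (compMean_nonneg p n t))
  have e2 : ((m : ℝ) - n) / (2 * m) = (m - n) / m / 2 := by
    field_simp
  have e4 : (t : ℝ) / (2 * m) = t / m / 2 := by
    field_simp
  rw [hut, e2, e4, sub_self, zero_div]
  set y := ((m : ℝ) - n) / m
  set τ := (t : ℝ) / m
  have h5 : (y + τ) ^ 3 ≤ (21 / 10 * ε) ^ 3 :=
    pow_le_pow_left₀ (by linarith) (by linarith) 3
  have h6 : y * (y / 2 - ε) ≤ -(20 * ε ^ 3) := by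
    have h7 : y / 2 - ε ≤ -(20 * ε ^ 2) := by linarith
    nlinarith
  have h9 : y * (τ / 2) ≤ ε * τ := by
    have : y ≤ 2 * ε := by linarith
    nlinarith
  have h10 : 0 ≤ ε ^ 3 := by positivity
  have h11 : y * (0 + y / 2 + τ / 2 - ε) = y * (y / 2 - ε) + y * (τ / 2) := by ring
  rw [h11]
  linarith

/-- With s = εt²/m, e^s ≤ 1 + s e^s. Here s ≤ ε²t/10, so the decay 3ε²t/10 leaves e^(-u) with u =
ε²t/5, and u e^(-u) ≤ 1 reduces the t² in s to a single t. -/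
theorem exp_mul_compMean_le (hm : 0 < m) (hε : 0 < ε) {n N t : ℕ}
    (h : compMean p n t ≤ Real.exp (-(3 / 10 * ε ^ 2 * t)) * compMean p N t)
    (ht : (t : ℝ) / m ≤ ε / 10) :
    compMean p n t * Real.exp (t * (ε * (t / m))) ≤
      compMean p n t + 5 / (ε * m) * (t * compMean p N t) := by
  have hm0 : (0 : ℝ) < m := by exact_mod_cast hm
  have h0 := compMean_nonneg p n t
  have h0' := compMean_nonneg p N t
  set s := (t : ℝ) * (ε * (t / m)) with hs
  have hs0 : 0 ≤ s := by positivity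
  have hs1 : s ≤ ε ^ 2 / 10 * t := by
    calc s ≤ (t : ℝ) * (ε * (ε / 10)) := by
          rw [hs]
          gcongr
      _ = _ := by ring
  have h3 : Real.exp s ≤ 1 + s * Real.exp s := by
    have h4 := Real.add_one_le_exp (-s)
    have h5 : Real.exp (-s) * Real.exp s = 1 := by rw [← Real.exp_add]; simp
    nlinarith [Real.exp_pos s]
  have h6 : s * Real.exp s * compMean p n t ≤ 5 / (ε * m) * (t * compMean p N t) := by
    calc _ ≤ s * Real.exp (ε ^ 2 / 10 * t) *
          (Real.exp (-(3 / 10 * ε ^ 2 * t)) * compMean p N t) := by gcongr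
      _ = s * (Real.exp (ε ^ 2 / 10 * t) * Real.exp (-(3 / 10 * ε ^ 2 * t))) * compMean p N t := by
          ring
      _ = s * Real.exp (-(ε ^ 2 * t / 5)) * compMean p N t := by
          rw [← Real.exp_add]
          ring_nf
      _ = 5 / (ε * m) * (t * compMean p N t) *
          (ε ^ 2 * t / 5 * Real.exp (-(ε ^ 2 * t / 5))) := by
          have : s = 5 / (ε * m) * t * (ε ^ 2 * t / 5) := by
            rw [hs]
            field_simp
          rw [this]
          ring
      _ ≤ 5 / (ε * m) * (t * compMean p N t) * 1 := by
          gcongr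
          have h7 := Real.add_one_le_exp (ε ^ 2 * t / 5)
          rw [Real.exp_neg, ← div_eq_mul_inv, div_le_one (Real.exp_pos _)]
          linarith
      _ = _ := mul_one _
  nlinarith

/-- The order m - d + e, e ≈ εm/2, lies between the dual order m - d and the critical one: far
enough above the former to supply decay in t, yet with 1 - Np ≥ 2ε/5. The second moment there is at
most 5m/(2ε), and the factor 5/(εm) turns it into 25/(2ε²). -/
theorem le_bigMean (hp : (p : ℝ) = (1 + ε) / m) (hm : 4 ≤ m) (hε : 0 < ε)
    (hε1 : ε ≤ 1 / 1000) (hH : 1000 ≤ ε ^ 3 * m) {k : ℕ}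
    (hk : ∀ t : ℕ, t < k → (t : ℝ) / m ≤ ε / 10) :
    2 * ε * m - 40 * ε ^ 2 * m - 1 - 25 / 2 * (1 / ε ^ 2) ≤ bigMean p k m := by
  have hm0 : (0 : ℝ) < m := by exact_mod_cast (by omega : 0 < m)
  have hr : 1 / (m : ℝ) ≤ ε ^ 3 / 1000 := by
    rw [div_le_iff₀ hm0]
    linarith
  have hr2 : 1 / (m : ℝ) ≤ ε / 1000 := hr.trans (by nlinarith [sq_nonneg ε])
  have he2 : ε ^ 2 ≤ ε / 1000 := by nlinarith
  obtain ⟨d, hd1, hd2⟩ := exists_nat_div_mem (m := m) (by omega) (x := 2 * ε - 40 * ε ^ 2)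
    (by linarith)
  obtain ⟨e, he1, he2'⟩ := exists_nat_div_mem (m := m) (by omega) (x := ε / 2) (by positivity)
  have hdm : d ≤ m := by
    have h1 : (d : ℝ) ≤ (2 * ε - 40 * ε ^ 2) * m := by rwa [div_le_iff₀ hm0] at hd2
    have h2 : (d : ℝ) ≤ m := by nlinarith
    exact_mod_cast h2
  have hed : e ≤ d := by
    have h1 : (e : ℝ) / m ≤ d / m := by linarith
    rw [div_le_div_iff_of_pos_right hm0] at h1
    exact_mod_cast h1
  have hn : ((m - d : ℕ) : ℝ) = m - d := Nat.cast_sub hdm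
  have hNm : m - d + e ≤ m := by omega
  have hN : ((m - d + e : ℕ) : ℝ) = m - d + e := by
    rw [Nat.cast_add, hn]
  have he0 : 0 < e := by
    rw [Nat.pos_iff_ne_zero]
    rintro rfl
    rw [Nat.cast_zero, zero_div] at he1
    linarith
  have hmn : ((m : ℝ) - (m - d : ℕ)) / m = d / m := by
    rw [hn, sub_sub_cancel]
  have hstep : ∀ t ∈ Finset.range (m + 1), compMean p m t * (if t < k then 1 else 0) ≤
      compMean p (m - d) t + 5 / (ε * m) * (t * compMean p (m - d + e) t) := by
    intro t ht
    have h0 := compMean_nonneg p (m - d) t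
    have h0' := compMean_nonneg p (m - d + e) t
    split_ifs with htk
    · rw [mul_one]
      have htm := hk t htk
      exact (compMean_le_mul_exp_sq (n := m - d) hp hm hε hε1 (by rw [hmn]; linarith)
        (by rw [hmn]; exact hd2) (Nat.sub_le m d) htm).trans (exp_mul_compMean_le (by omega) hε
          (compMean_le_exp_neg_mul hp hm hε hε1 hr2 (by rw [hmn]; exact hd1) (by omega) hNm he1
            he2' t) htm)
    · rw [mul_zero]
      positivity
  have h1 := Finset.sum_le_sum hstep
  rw [Finset.sum_add_distrib, ← Finset.mul_sum, sum_compMean_of_lt (by omega), hn] at h1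
  have hpN : 2 / 5 * ε ≤ 1 - ((m - d + e : ℕ) : ℝ) * p := by
    have h2 : ((m - d + e : ℕ) : ℝ) * p = (1 - d / m + e / m) * (1 + ε) := by
      rw [hN, hp]
      field_simp
    have h3 : 1 - (d : ℝ) / m + e / m ≤ 1 - 7 / 5 * ε := by linarith
    rw [h2]
    nlinarith
  have hNhalf : (m : ℝ) / 2 ≤ (m - d + e : ℕ) := by
    rw [hN]
    have h2 : (d : ℝ) ≤ (2 * ε - 40 * ε ^ 2) * m := by rwa [div_le_iff₀ hm0] at hd2
    have : (0 : ℝ) ≤ e := Nat.cast_nonneg e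
    nlinarith [sq_nonneg ε]
  have hεm : 1000 ≤ ε * m := by
    have : ε ^ 3 * m ≤ ε * m := by
      gcongr
      nlinarith [sq_nonneg ε]
    linarith
  have h2 := sum_mul_compMean_le (p := p) (N := m - d + e) (by nlinarith)
  have h3 : ∑ t ∈ Finset.range (m + 1), t * compMean p (m - d + e) t =
      ∑ t ∈ Finset.range (m - d + e + 1), t * compMean p (m - d + e) t := by
    symm
    refine Finset.sum_subset (Finset.range_subset_range.2 (by omega)) fun t _ ht => ?_
    rw [compMean_eq_zero, mul_zero]
    simp only [Finset.mem_range] at ht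
    omega
  rw [h3] at h1
  set S := ∑ t ∈ Finset.range (m - d + e + 1), t * compMean p (m - d + e) t
  have hS0 : 0 ≤ S := Finset.sum_nonneg fun t _ =>
    mul_nonneg (Nat.cast_nonneg t) (compMean_nonneg p _ t)
  have hS : 2 / 5 * ε * S ≤ m :=
    (mul_le_mul_of_nonneg_right hpN hS0).trans (h2.trans (by exact_mod_cast hNm))
  have h4 : 5 / (ε * m) * S ≤ 25 / 2 * (1 / ε ^ 2) := by
    rw [div_mul_eq_mul_div, mul_one_div, div_le_div_iff₀ (by positivity) (by positivity)]
    nlinarith [mul_le_mul_of_nonneg_left hS hε.le]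
  have h5 := bigMean_add_sum (p := p) k m
  have h6 : (2 * ε - 40 * ε ^ 2) * m - 1 ≤ d := by
    rw [sub_le_iff_le_add, ← add_div, le_div_iff₀ hm0] at hd1
    linarith
  linarith

end SimpleGraph

/-! ### Assembling the two bounds. -/

namespace SimpleGraph

theorem expectedLargestComponent_bounds {p : unitInterval} {m : ℕ} {ε : ℝ}
    (hp : (p : ℝ) = (1 + ε) / m) (hm : 4 ≤ m) (hε : 0 < ε) (hε1 : ε ≤ 1 / 1000)
    (hH : 6400 * Real.log m ≤ ε ^ 3 * m) :
    expectedLargestComponent m p ≤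
        2 * ε * m - 8 / 3 * ε ^ 2 * m + 100 * (ε ^ 3 * m) ∧
      2 * ε * m - 100 * (ε ^ (-2 : ℤ) + ε ^ 2 * m) ≤ expectedLargestComponent m p := by
  have hm' : (4 : ℝ) ≤ m := by exact_mod_cast hm
  have hm0 : (0 : ℝ) < m := by linarith
  have hlog : 1 ≤ Real.log m := by
    rw [Real.le_log_iff_exp_le hm0]
    linarith [Real.exp_one_lt_d9]
  have hH1 : 1000 ≤ ε ^ 3 * m := by linarith
  set k := ⌈ε * m / 10⌉₊ with hk
  have hk1 : ε * m / 10 ≤ k := Nat.le_ceil _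
  have hk2 : ∀ t : ℕ, t < k → (t : ℝ) / m ≤ ε / 10 := fun t ht => by
    rw [div_le_iff₀ hm0]
    linarith [Nat.lt_ceil.1 ht]
  have hkm : (k : ℝ) ≤ m := by
    have : k ≤ m := Nat.ceil_le.2 (by nlinarith)
    exact_mod_cast this
  have hm2 : (m : ℝ) ^ 2 = Real.exp (2 * Real.log m) := by
    rw [mul_comm, Real.exp_mul, Real.exp_log hm0, Real.rpow_two]
  have hexp : ∀ x : ℝ, 2 * Real.log m ≤ x → (m : ℝ) ^ 2 * Real.exp (-x) ≤ 1 := fun x hx => by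
    rw [hm2, ← Real.exp_add, Real.exp_le_one_iff]
    linarith
  -- As k ≥ εm/10, the exponent is at least ε³m/1280 ≥ 5 log m by the choice 6400, more than enough
  -- to beat m².
  have hE1 := hexp (ε ^ 2 * k / 128) (by nlinarith [mul_le_mul_of_nonneg_left hk1 (sq_nonneg ε)])
  have hE2 := hexp (ε ^ 2 / 80 * (m - m * (1 - ε / 2))) (by nlinarith)
  have hmul : ∀ y : ℝ, 0 ≤ y → (m : ℝ) * y ≤ m ^ 2 * y := fun y hy =>
    mul_le_mul_of_nonneg_right (by nlinarith) hy
  constructor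
  · have h1 := expectedLargestComponent_le p k m
    have h2 := bigMean_le_upper hp hm hε hε1 hH1 k
    have h3 := noBigProb_le_exp hp hm hε hε1 hH1 hk2 m le_rfl
    have h4 : k * noBigProb p k m ≤
        m * Real.exp (-(ε ^ 2 / 80 * (m - m * (1 - ε / 2)))) :=
      mul_le_mul hkm h3 (noBigProb_nonneg p k m) hm0.le
    have h5 := hmul _ (Real.exp_pos (-(ε ^ 2 * k / 128))).le
    have h6 := hmul _ (Real.exp_pos (-(ε ^ 2 / 80 * (m - m * (1 - ε / 2))))).le
    linarith
  · have h1 := bigMean_le p k m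
    have h2 := sum_compMean_mul_bigMean_le hp hm hε hε1 hH1 k
    have h3 := le_bigMean hp hm hε hε1 hH1 hk2
    have h4 : ε ^ (-2 : ℤ) = 1 / ε ^ 2 := by
      rw [zpow_neg, one_div]
      norm_cast
    have h5 : 1 ≤ 1 / ε ^ 2 := by
      rw [le_div_iff₀ (by positivity)]
      nlinarith
    have h6 : 0 ≤ ε ^ 2 * m := by positivity
    rw [h4]
    linarith

end SimpleGraph

theorem mainTheorem3 :
    ∃ A : ℝ, 0 < A ∧ ∃ C : ℝ, 0 < C ∧
      ∀ (ε : ℕ → ℝ) (p : ℕ → unitInterval),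
        Tendsto ε atTop (𝓝 0) →
        (∀ᶠ m : ℕ in atTop, A * Real.log m ≤ ε m ^ 3 * m) →
        (∀ᶠ m : ℕ in atTop, (p m : ℝ) = (1 + ε m) / m) →
        ∀ᶠ m : ℕ in atTop,
          expectedLargestComponent m (p m)
              ≤ 2 * ε m * m - 8 / 3 * ε m ^ 2 * m + C * (ε m ^ 3 * m) ∧
          2 * ε m * m - C * (ε m ^ (-2 : ℤ) + ε m ^ 2 * m)
              ≤ expectedLargestComponent m (p m) := by
  refine ⟨6400, by norm_num, 100, by norm_num, fun ε p h0 hA hp => ?_⟩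
  filter_upwards [hA, hp, h0.eventually_le_const (by norm_num : (0 : ℝ) < 1 / 1000),
    eventually_ge_atTop 4] with m hA hp h0 hm
  refine SimpleGraph.expectedLargestComponent_bounds hp hm ?_ h0 hA
  -- Positivity of ε is not assumed: it follows from ε³m ≥ 6400 log m > 0, since a cube has the sign
  -- of its base.
  by_contra hneg
  have hm' : (4 : ℝ) ≤ m := by exact_mod_cast hm
  have hlog : 0 < Real.log m := Real.log_pos (by linarith)
  have h1 : ε m ^ 3 ≤ 0 := by
    have : 0 ≤ (-ε m) ^ 3 := pow_nonneg (by linarith) 3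
    linarith [Odd.neg_pow (by decide : Odd 3) (ε m)]
  nlinarith
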